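/- For a finite connected graph $G=(V,E)$ (parallel edges are allowed; loops may occur but do not affect what follows), let $$R(G;p)=\sum_{\substack{A\subseteq E\\ (V,A)\text{ connected}}}(1-p)^{|A|}p^{|E|-|A|}$$ be its (all-terminal) reliability polynomial, and let $$\mathcal Z=\{p\in\mathbb C : R(G;p)=0\text{ for some finite connected graph }G\}$$ be the set of all reliability zeros. (1) Let $p\in\mathbb C$ be such that $|p|=1$ and $p^k\neq 1$ for $k=1,\dots,4$. Then there exists $\varepsilon=\varepsilon_p>0$ such that the disk $B(p,\varepsilon)$ is contained in the closure $\overline{\mathcal Z}$ of $\mathcal Z$. (2) Consequently there are reliability zeros of modulus larger than $1$ in essentially every direction: for every $q\in\mathbb C$ with $|q|=1$ and every $\delta>0$ there is $z\in\mathcal Z$ with $|z|>1$ and $\bigl|z/|z|-q\bigr|<\delta$; that is, the set of directions $z/|z|$ of reliability zeros $z$ with $|z|>1$ is dense in the unit circle. -/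

import Mathlib

open Polynomial

namespace Reliability

/-- A multigraph is connected if it has a vertex and any two of its vertices are joined by a
(possibly trivial) path. -/
def IsConnected {V E : Type} (G : Graph V E) : Prop :=
  G.vertexSet.Nonempty ∧
    ∀ x ∈ G.vertexSet, ∀ y ∈ G.vertexSet, Relation.ReflTransGen G.Adj x y

open Classical in
/-- The (all-terminal) reliability polynomial of a multigraph `G` with finitely many edges,
in the edge failure probability: the sum of `(1 - p)^|A| p^(|E| - |A|)` over all sets `A` of
edges of `G` such that the spanning subgraph with edge set `A` is connected. -/
noncomputable def reliabilityPolynomial {V E : Type} (G : Graph V E) (hE : G.edgeSet.Finite) :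
    ℂ[X] :=
  ∑ A ∈ hE.toFinset.powerset.filter (fun A : Finset E => IsConnected (G.restrict (A : Set E))),
    (1 - X) ^ A.card * X ^ (hE.toFinset.card - A.card)

/-- The set of all reliability zeros: the complex zeros of the reliability polynomials of all
finite connected multigraphs. -/
def reliabilityZeros : Set ℂ :=
  {p | ∃ (V E : Type) (G : Graph V E) (_ : G.vertexSet.Finite) (hE : G.edgeSet.Finite),
    IsConnected G ∧ (reliabilityPolynomial G hE).eval p = 0}

end Reliability

/-!
A two-terminal network has the generating functions `merged` (edge sets that connect the network
once the terminals are identified) and `split` (edge sets leaving two components, one around each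
terminal), and its reliability polynomial is `merged - split` (`Network.rel_eq`). Both functions are
multiplicative under parallel composition (`Network.parallel_merged`, `Network.parallel_split`).
So if the ratios `g = split / merged` of some networks satisfy `g₀ ^ A * g₁ ^ B * g₂ ^ C = 1` at
`z`, then `z` is a zero of the reliability polynomial of a parallel composition of copies of them
(`Network.mem_reliabilityZeros_of_prod_eq_one`).

Let `|p| = 1`, where `p` is not a root of unity of order at most `4`. Three networks are used: one
with `|g₀| < 1` at `p`, the path of two edges with `|g₁| > 1` at `p`, and a single edge, for which
`g₂ = p` has modulus `1` at `p` and nonzero derivative. Near any point close to `p` one can choose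
nonnegative real exponents such that the product of the `|gᵢ|` is `1` while the logarithmic
derivative of the product of the `gᵢ` does not vanish (`exists_nonneg_combination`). Rounding large
multiples of the exponents to natural numbers changes the logarithm of the product only by a bounded
amount, while the image of a small disc under it grows linearly; hence the logarithm takes a
value in `2 * π * I * ℤ` on that disc (`frequently_nat_combination`). Thus reliability zeros are
dense near `p`. The statement about directions follows, since the admissible `p` are dense in the
unit circle.

The first network is the main point. Suppose `z` is on the unit circle at an angle between `40°` and
`72°`. On the complete graph on the terminals and four further vertices, without the edge between
the terminals, put failure weights that are powers `z ^ i` with `|i| ≤ 2`; for suitable `i`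
the network has `|split| < |merged|` (`Network.gadget_norm_lt`). The generating functions are
computed from the recursion that sorts edge sets by the component of a root
(`sum_relOn_mul_cutWeight`).
Every admissible `p` has a power `z` in that arc (`exists_zpow_re_mem`), the inverse of `z` is
a limit of powers of `p` with positive exponents (`exists_pow_near_zpow`), and `k` parallel edges
act as one edge with failure weight `p ^ k`; so some network of genuine edges has
`|split| < |merged|` at `p` (`Network.exists_gadget`).
-/

namespace Reliability

/-! ### State sums over edge sets -/

open Classical in
/-- The sum, over all edge sets `A` (encoded by their indicator functions) with property `Q`, of the
product of the weights `a e` of the edges in `A` and `b e` of the edges outside `A`. -/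
noncomputable def stateSum {E : Type} [Fintype E] (a b : E → ℂ) (Q : (E → Bool) → Prop) : ℂ :=
  ∑ A : E → Bool, if Q A then ∏ e, (if A e then a e else b e) else 0

lemma stateSum_congr {E : Type} [Fintype E] {a b : E → ℂ} {Q Q' : (E → Bool) → Prop}
    (h : ∀ A, Q A ↔ Q' A) : stateSum a b Q = stateSum a b Q' := by
  rw [show Q = Q' from funext fun A => propext (h A)]

lemma stateSum_add_stateSum_not {E : Type} [Fintype E] (a b : E → ℂ) (Q P : (E → Bool) → Prop) :
    stateSum a b (fun A => Q A ∧ P A) + stateSum a b (fun A => Q A ∧ ¬ P A) = stateSum a b Q := by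
  classical
  unfold stateSum
  rw [← Finset.sum_add_distrib]
  refine Finset.sum_congr rfl fun A _ => ?_
  by_cases hQ : Q A <;> by_cases hP : P A <;> simp [hQ, hP]

open Classical in
lemma stateSum_true {E : Type} [Fintype E] (a b : E → ℂ) :
    stateSum a b (fun _ => True) = ∏ e, (a e + b e) := by
  have := Finset.prod_univ_sum (fun _ : E => (Finset.univ : Finset Bool))
    (fun e i => if i then a e else b e)
  simp only [Fintype.univ_bool, Finset.sum_insert, Finset.mem_singleton, Bool.true_eq_false,
    not_false_eq_true, Finset.sum_singleton, if_true, Bool.false_eq_true, if_false] at this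
  rw [this]
  unfold stateSum
  simp only [if_true]
  refine Finset.sum_congr ?_ fun _ _ => rfl
  ext; simp

lemma exists_of_stateSum_ne_zero {E : Type} [Fintype E] {a b : E → ℂ} {Q : (E → Bool) → Prop}
    (h : stateSum a b Q ≠ 0) : ∃ A, Q A := by
  by_contra hQ
  push Not at hQ
  exact h (by simp [stateSum, hQ])

/-- State sums over the edges of a disjoint union of networks: summing over the restrictions of the
edge set first leaves a state sum over the index type. -/
lemma stateSum_sigma {ι : Type} [Fintype ι] {E : ι → Type} [∀ i, Fintype (E i)]
    (a b : (Σ i, E i) → ℂ) (P C : ∀ i, (E i → Bool) → Prop) (Q : (ι → Bool) → Prop)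
    (R : ((Σ i, E i) → Bool) → Prop)
    (hR : ∀ A B, (∀ i, B i = true ↔ C i (fun e => A ⟨i, e⟩)) →
      (R A ↔ (∀ i, P i (fun e => A ⟨i, e⟩)) ∧ Q B)) :
    stateSum a b R =
      stateSum (fun i => stateSum (fun e => a ⟨i, e⟩) (fun e => b ⟨i, e⟩) fun A => P i A ∧ C i A)
        (fun i => stateSum (fun e => a ⟨i, e⟩) (fun e => b ⟨i, e⟩) fun A => P i A ∧ ¬ C i A) Q := by
  classical
  have key : ∀ B : ι → Bool,
      (∏ i, if B i then
          stateSum (fun e => a ⟨i, e⟩) (fun e => b ⟨i, e⟩) (fun A => P i A ∧ C i A)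
        else stateSum (fun e => a ⟨i, e⟩) (fun e => b ⟨i, e⟩) fun A => P i A ∧ ¬ C i A) =
      ∑ A : ∀ i, E i → Bool, if (∀ i, P i (A i)) ∧ (∀ i, B i = true ↔ C i (A i)) then
        ∏ i, ∏ e, (if A i e then a ⟨i, e⟩ else b ⟨i, e⟩) else 0 := by
    intro B
    have h1 : ∀ i, (if B i then
          stateSum (fun e => a ⟨i, e⟩) (fun e => b ⟨i, e⟩) (fun A => P i A ∧ C i A)
        else stateSum (fun e => a ⟨i, e⟩) (fun e => b ⟨i, e⟩) fun A => P i A ∧ ¬ C i A) =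
        ∑ A : E i → Bool, if P i A ∧ (B i = true ↔ C i A) then
          ∏ e, (if A e then a ⟨i, e⟩ else b ⟨i, e⟩) else 0 := by
      intro i
      cases h : B i <;> simp [stateSum]
    simp_rw [h1]
    rw [Finset.prod_univ_sum]
    refine Finset.sum_congr (by ext; simp) fun A _ => ?_
    rw [Finset.prod_ite_zero]
    simp only [Finset.mem_univ, forall_true_left, forall_and]
  have h2 : stateSum a b R = ∑ A : ∀ i, E i → Bool,
      if R (fun x => A x.1 x.2) then
        ∏ i, ∏ e, (if A i e then a ⟨i, e⟩ else b ⟨i, e⟩) else 0 := by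
    let φ : ((Σ i, E i) → Bool) ≃ (∀ i, E i → Bool) := Equiv.piCurry fun i (_ : E i) => Bool
    rw [← φ.sum_comp]
    unfold stateSum
    refine Finset.sum_congr (by ext; simp) fun A _ => ?_
    rw [Fintype.prod_sigma]
    rfl
  have h3 : ∀ f g : ι → ℂ, stateSum f g Q =
      ∑ B : ι → Bool, if Q B then ∏ i, (if B i then f i else g i) else 0 := fun _ _ => rfl
  rw [h2, h3]
  simp_rw [key]
  -- Exchange the sums; for a fixed edge set only its own pattern `B` contributes.
  have h4 : ∀ (B : ι → Bool) (S : (∀ i, E i → Bool) → ℂ),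
      (if Q B then ∑ A, S A else 0) = ∑ A, if Q B then S A else 0 := by
    intro B S
    split_ifs <;> simp
  simp_rw [h4]
  rw [Finset.sum_comm]
  refine Finset.sum_congr rfl fun A _ => ?_
  rw [Finset.sum_eq_single (fun i => decide (C i (A i)))]
  · have h5 := hR (fun x => A x.1 x.2) (fun i => decide (C i (A i))) (by simp)
    by_cases hr : R (fun x => A x.1 x.2)
    · have h6 := h5.1 hr
      simp [hr, h6.1, h6.2]
    · rw [if_neg hr]
      by_cases hq : Q (fun i => decide (C i (A i)))
      · rw [if_pos hq, if_neg]
        intro h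
        exact hr (h5.2 ⟨h.1, hq⟩)
      · rw [if_neg hq]
  · intro B _ hB
    have : ¬ ((∀ i, P i (A i)) ∧ ∀ i, B i = true ↔ C i (A i)) := by
      rintro ⟨-, h⟩
      apply hB
      funext i
      rw [Bool.eq_iff_iff, h i]
      simp
    simp [this]
  · simp

/-! ### Two-terminal networks -/

/-- A two-terminal network: a finite multigraph whose vertices are the terminals `inl false`,
`inl true` and the interior vertices `inr w`. -/
structure Network where
  /-- The interior vertices. -/
  W : Type
  /-- The edges. -/
  E : Type
  [fintypeW : Fintype W]
  [fintypeE : Fintype E]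
  /-- The first end of an edge. -/
  fst : E → Bool ⊕ W
  /-- The second end of an edge. -/
  snd : E → Bool ⊕ W

attribute [instance] Network.fintypeW Network.fintypeE

namespace Network

/-- The edge set `A` connects the network, after the terminals have been identified in case `m`
holds. Connectedness is expressed by two-colourings: every colouring of the vertices that is
constant along the edges of `A` (and gives the terminals the same colour if `m` holds) is
constant. -/
def Good (N : Network) (m : Prop) (A : N.E → Bool) : Prop :=
  ∀ c : Bool ⊕ N.W → Prop, (∀ e, A e = true → (c (N.fst e) ↔ c (N.snd e))) →
    (m → (c (.inl false) ↔ c (.inl true))) → ∀ v, c v ↔ c (.inl false)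

lemma Good.merge {N : Network} {A : N.E → Bool} (h : N.Good False A) (m : Prop) : N.Good m A :=
  fun c hc _ => h c hc False.elim

lemma Good.mono {N : Network} {m : Prop} {A B : N.E → Bool} (h : N.Good m A)
    (hAB : ∀ e, A e = true → B e = true) : N.Good m B :=
  fun c hc hm => h c (fun e he => hc e (hAB e he)) hm

/-- The edge set `A` leaves exactly two components, which are separated by the terminals. -/
def Split (N : Network) (A : N.E → Bool) : Prop := N.Good True A ∧ ¬ N.Good False A

/-- The reliability polynomial of the network after identification of its terminals. -/
noncomputable def merged (N : Network) (p : ℂ) : ℂ :=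
  stateSum (fun _ => 1 - p) (fun _ => p) (N.Good True)

/-- The generating function of the edge sets that leave exactly two components, which are separated
by the terminals. -/
noncomputable def split (N : Network) (p : ℂ) : ℂ :=
  stateSum (fun _ => 1 - p) (fun _ => p) N.Split

/-- The reliability polynomial of the network. -/
noncomputable def rel (N : Network) (p : ℂ) : ℂ :=
  stateSum (fun _ => 1 - p) (fun _ => p) (N.Good False)

lemma good_true_and_good_false (N : Network) (A : N.E → Bool) :
    N.Good True A ∧ N.Good False A ↔ N.Good False A :=
  ⟨fun h => h.2, fun h => ⟨h.merge _, h⟩⟩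

lemma rel_add_split (N : Network) (p : ℂ) : N.rel p + N.split p = N.merged p := by
  unfold merged
  rw [← stateSum_add_stateSum_not _ _ (N.Good True) (N.Good False), rel, split]
  congr 1
  exact stateSum_congr fun A => (N.good_true_and_good_false A).symm

lemma rel_eq (N : Network) (p : ℂ) : N.rel p = N.merged p - N.split p := by
  rw [← N.rel_add_split p]; ring

/-- The network obtained from `H` by replacing each edge `e` by the network `N e`, the ends of `e`
becoming the terminals of `N e`. -/
def subst (H : Network) (N : H.E → Network) : Network where
  W := H.W ⊕ Σ e, (N e).W
  E := Σ e, (N e).E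
  fst x := Sum.elim (fun b => Sum.map id .inl (bif b then H.snd x.1 else H.fst x.1))
    (fun w => .inr (.inr ⟨x.1, w⟩)) ((N x.1).fst x.2)
  snd x := Sum.elim (fun b => Sum.map id .inl (bif b then H.snd x.1 else H.fst x.1))
    (fun w => .inr (.inr ⟨x.1, w⟩)) ((N x.1).snd x.2)

/-- The map from the vertices of `N e` to those of `H.subst N`. -/
def substInclusion (H : Network) (N : H.E → Network) (e : H.E) :
    Bool ⊕ (N e).W → Bool ⊕ (H.subst N).W :=
  Sum.elim (fun b => Sum.map id .inl (bif b then H.snd e else H.fst e))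
    (fun w => .inr (.inr ⟨e, w⟩))

/-- Connectedness after substitution: `B` is the set of the edges of `H` whose replacements join
their terminals. -/
lemma subst_good_iff (H : Network) (N : H.E → Network) (m : Prop) (A : (H.subst N).E → Bool)
    (B : H.E → Bool) (hB : ∀ e, B e = true ↔ (N e).Good False fun x => A ⟨e, x⟩) :
    (H.subst N).Good m A ↔ (∀ e, (N e).Good True fun x => A ⟨e, x⟩) ∧ H.Good m B := by
  classical
  -- A colouring of `H.subst N` amounts to one of `H` and compatible ones of the `N e`.
  have glue : ∀ (c : Bool ⊕ H.W → Prop) (d : ∀ e, Bool ⊕ (N e).W → Prop),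
      (∀ e, d e (.inl false) = c (H.fst e)) → (∀ e, d e (.inl true) = c (H.snd e)) →
      ∃ c' : Bool ⊕ (H.subst N).W → Prop, (∀ v, c' (Sum.map id .inl v) = c v) ∧
        ∀ e v, c' (H.substInclusion N e v) = d e v := by
    intro c d h0 h1
    let c' : Bool ⊕ (H.W ⊕ Σ e, (N e).W) → Prop :=
      Sum.elim (fun b => c (.inl b)) (Sum.elim (fun w => c (.inr w)) fun x => d x.1 (.inr x.2))
    have hc' : ∀ v : Bool ⊕ H.W, c' (Sum.map id .inl v) = c v := by
      rintro (b | w) <;> rfl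
    refine ⟨c', hc', ?_⟩
    rintro e ((_ | _) | w)
    · exact (hc' _).trans (h0 e).symm
    · exact (hc' _).trans (h1 e).symm
    · rfl
  constructor
  · intro h
    have hT : ∀ e, (N e).Good True fun x => A ⟨e, x⟩ := by
      intro e c hc hm
      obtain ⟨c', h1, h2⟩ := glue (fun _ => c (.inl false))
        (fun e' => if h : e' = e then h ▸ c else fun _ => c (.inl false))
        (by
          intro e'
          by_cases he : e' = e
          · subst he; simp
          · simp [he])
        (by
          intro e'
          by_cases he : e' = e
          · subst he; simpa using (propext (hm trivial)).symm
          · simp [he])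
      have h3 := h c' (by
        rintro ⟨e', x⟩ hx
        change c' (H.substInclusion N e' _) ↔ c' (H.substInclusion N e' _)
        rw [h2, h2]
        by_cases he : e' = e
        · subst he; simpa using hc x hx
        · simp [he]) (by
        intro _
        have e1 : c' (.inl false) = _ := h1 (.inl false)
        have e2 : c' (.inl true) = _ := h1 (.inl true)
        rw [e1, e2])
      intro v
      have h4 := h3 (H.substInclusion N e v)
      have e1 : c' (.inl false) = _ := h1 (.inl false)
      rw [h2, e1] at h4
      simpa using h4
    · refine ⟨hT, fun c hc hm => ?_⟩
      have hd : ∀ e, ∃ d : Bool ⊕ (N e).W → Prop, d (.inl false) = c (H.fst e) ∧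
          d (.inl true) = c (H.snd e) ∧
          ∀ x, A ⟨e, x⟩ = true → (d ((N e).fst x) ↔ d ((N e).snd x)) := by
        intro e
        by_cases hs : c (H.fst e) ↔ c (H.snd e)
        · exact ⟨fun _ => c (H.fst e), rfl, propext hs, fun _ _ => Iff.rfl⟩
        · have hn : ¬ (N e).Good False fun x => A ⟨e, x⟩ := fun hg => hs (hc e ((hB e).2 hg))
          -- A colouring of `N e` that separates the terminals, or its negative, fits `c`.
          have : ∃ d : Bool ⊕ (N e).W → Prop, ¬ (d (.inl false) ↔ d (.inl true)) ∧
              ∀ x, A ⟨e, x⟩ = true → (d ((N e).fst x) ↔ d ((N e).snd x)) := by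
            by_contra hcon
            push Not at hcon
            refine hn fun d hd _ => hT e d hd fun _ => ?_
            by_contra hne
            obtain ⟨x, hx, hx'⟩ := hcon d (by tauto)
            have := hd x hx
            tauto
          obtain ⟨d, hd1, hd2⟩ := this
          by_cases h0 : d (.inl false) ↔ c (H.fst e)
          · exact ⟨d, propext h0, propext (by tauto), hd2⟩
          · exact ⟨fun v => ¬ d v, propext (by tauto), propext (by tauto),
              fun x hx => not_congr (hd2 x hx)⟩
      choose d hd1 hd2 hd3 using hd
      obtain ⟨c', h1, h2⟩ := glue c d hd1 hd2
      have h3 := h c' (by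
        rintro ⟨e', x⟩ hx
        change c' (H.substInclusion N e' _) ↔ c' (H.substInclusion N e' _)
        rw [h2, h2]
        exact hd3 e' x hx) (by
        intro hm'
        have e1 : c' (.inl false) = _ := h1 (.inl false)
        have e2 : c' (.inl true) = _ := h1 (.inl true)
        rw [e1, e2]
        exact hm hm')
      intro v
      have h4 := h3 (Sum.map id .inl v)
      have e1 : c' (.inl false) = _ := h1 (.inl false)
      rwa [h1, e1] at h4
  · rintro ⟨hT, hG⟩ c hc hm
    have hN : ∀ e, ∀ x, A ⟨e, x⟩ = true → (c (H.substInclusion N e ((N e).fst x)) ↔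
        c (H.substInclusion N e ((N e).snd x))) := fun e x hx => hc ⟨e, x⟩ hx
    have h1 := hG (fun v => c (Sum.map id .inl v)) (by
      intro e he
      have := (hB e).1 he (fun v => c (H.substInclusion N e v)) (hN e) False.elim (.inl true)
      exact this.symm) hm
    rintro (b | w | ⟨e, w⟩)
    · exact h1 (.inl b)
    · exact h1 (.inr w)
    · have h2 := hT e (fun v => c (H.substInclusion N e v)) (hN e)
        (fun _ => (h1 (H.fst e)).trans (h1 (H.snd e)).symm) (.inr w)
      exact h2.trans (h1 (H.fst e))

/-- After substitution an edge `e` of `H` acts as if it had the weight `(N e).rel p` when present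
and `(N e).split p` when absent. -/
lemma subst_stateSum (H : Network) (N : H.E → Network) (p : ℂ) (Q : (H.E → Bool) → Prop)
    (R : ((H.subst N).E → Bool) → Prop)
    (hR : ∀ A B, (∀ e, B e = true ↔ (N e).Good False fun x => A ⟨e, x⟩) →
      (R A ↔ (∀ e, (N e).Good True fun x => A ⟨e, x⟩) ∧ Q B)) :
    stateSum (fun _ : (H.subst N).E => 1 - p) (fun _ => p) R =
      stateSum (fun e => (N e).rel p) (fun e => (N e).split p) Q := by
  have := stateSum_sigma (fun _ : Σ e, (N e).E => 1 - p) (fun _ => p)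
    (fun e => (N e).Good True) (fun e => (N e).Good False) Q R hR
  refine this.trans ?_
  congr 1
  funext e
  exact stateSum_congr (N e).good_true_and_good_false

lemma subst_merged (H : Network) (N : H.E → Network) (p : ℂ) :
    (H.subst N).merged p =
      stateSum (fun e => (N e).rel p) (fun e => (N e).split p) (H.Good True) :=
  H.subst_stateSum N p _ _ fun A B h => H.subst_good_iff N True A B h

lemma subst_split (H : Network) (N : H.E → Network) (p : ℂ) :
    (H.subst N).split p =
      stateSum (fun e => (N e).rel p) (fun e => (N e).split p) H.Split :=
  H.subst_stateSum N p _ _ fun A B h => by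
    rw [Split, Split, H.subst_good_iff N True A B h, H.subst_good_iff N False A B h]
    tauto

/-! ### Parallel composition -/

/-- The network without interior vertices in which the terminals are joined by edges indexed by
`E`. -/
def dipole (E : Type) [Fintype E] : Network where
  W := Empty
  E := E
  fst _ := .inl false
  snd _ := .inl true

lemma dipole_good_true (E : Type) [Fintype E] (A : E → Bool) : (dipole E).Good True A := by
  rintro c - hm ((_ | _) | w)
  · exact Iff.rfl
  · exact (hm trivial).symm
  · exact w.elim

lemma dipole_good_false_iff (E : Type) [Fintype E] (A : E → Bool) :
    (dipole E).Good False A ↔ ∃ e, A e = true := by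
  constructor
  · intro h
    by_contra hA
    push Not at hA
    have := h (fun v => v = .inl false) (fun e he => absurd he (hA e)) False.elim (.inl true)
    simp at this
  · rintro ⟨e, he⟩ c hc - v
    exact dipole_good_true E A c hc (fun _ => hc e he) v

lemma dipole_stateSum_good (E : Type) [Fintype E] (a b : E → ℂ) :
    stateSum a b ((dipole E).Good True) = ∏ e, (a e + b e) := by
  rw [← stateSum_true]
  exact stateSum_congr fun A => iff_of_true (dipole_good_true E A) trivial

lemma dipole_stateSum_split (E : Type) [Fintype E] (a b : E → ℂ) :
    stateSum a b (dipole E).Split = ∏ e, b e := by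
  classical
  have h : ∀ A : E → Bool, (dipole E).Split A ↔ A = fun _ => false := by
    intro A
    unfold Split
    refine (and_congr_right' (dipole_good_false_iff E A).not).trans ?_
    refine ⟨fun h => funext fun e => ?_, ?_⟩
    · by_contra he
      exact h.2 ⟨e, by simpa using he⟩
    · rintro rfl
      exact ⟨dipole_good_true E _, by simp⟩
  rw [stateSum_congr h]
  unfold stateSum
  rw [Finset.sum_eq_single (fun _ => false)]
  · simp
  · intro A _ hA
    rw [if_neg hA]
  · simp

/-- The parallel composition of networks. -/
def parallel {ι : Type} [Fintype ι] (N : ι → Network) : Network := (dipole ι).subst N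

lemma parallel_merged {ι : Type} [Fintype ι] (N : ι → Network) (p : ℂ) :
    (parallel N).merged p = ∏ i, (N i).merged p :=
  ((subst_merged (dipole ι) N p).trans (dipole_stateSum_good ι _ _)).trans
    (Finset.prod_congr rfl fun i _ => (N i).rel_add_split p)

lemma parallel_split {ι : Type} [Fintype ι] (N : ι → Network) (p : ℂ) :
    (parallel N).split p = ∏ i, (N i).split p :=
  (subst_split (dipole ι) N p).trans (dipole_stateSum_split ι _ _)

lemma dipole_merged (E : Type) [Fintype E] (p : ℂ) : (dipole E).merged p = 1 :=
  (dipole_stateSum_good E _ _).trans (by simp)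

lemma dipole_split (E : Type) [Fintype E] (p : ℂ) :
    (dipole E).split p = p ^ Fintype.card E :=
  (dipole_stateSum_split E _ _).trans (by simp)

lemma dipole_rel (E : Type) [Fintype E] (p : ℂ) :
    (dipole E).rel p = 1 - p ^ Fintype.card E := by
  rw [rel_eq, dipole_merged, dipole_split]

/-- A parallel composition is connected if no factor has a component without terminals and some
factor joins its terminals. -/
lemma parallel_good_false {ι : Type} [Fintype ι] (N : ι → Network) {p : ℂ}
    (h : ∀ i, (N i).merged p ≠ 0) (i : ι) (hi : (N i).rel p ≠ 0) :
    (parallel N).Good False fun _ => true := by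
  classical
  refine ((dipole ι).subst_good_iff N False _
    (fun e => decide ((N e).Good False fun _ => true)) (by simp)).2 ⟨fun e => ?_, ?_⟩
  · obtain ⟨A, hA⟩ := exists_of_stateSum_ne_zero (h e)
    exact hA.mono fun _ _ => rfl
  · obtain ⟨A, hA⟩ := exists_of_stateSum_ne_zero hi
    exact (dipole_good_false_iff ι _).2 ⟨i, by simpa using hA.mono fun _ _ => rfl⟩

/-! ### Networks as graphs -/

/-- The multigraph underlying a network. -/
def toGraph (N : Network) : Graph (Bool ⊕ N.W) N.E where
  vertexSet := Set.univ
  IsLink e x y := (x = N.fst e ∧ y = N.snd e) ∨ (x = N.snd e ∧ y = N.fst e)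
  edgeSet := Set.univ
  isLink_symm _ _ := ⟨fun _ _ h => by tauto⟩
  eq_or_eq_of_isLink_of_isLink := by
    rintro e x y v w (⟨rfl, rfl⟩ | ⟨rfl, rfl⟩) (⟨rfl, rfl⟩ | ⟨rfl, rfl⟩) <;> simp
  edge_mem_iff_exists_isLink e := by
    exact iff_of_true (Set.mem_univ e) ⟨_, _, Or.inl ⟨rfl, rfl⟩⟩
  left_mem_of_isLink _ _ _ _ := trivial

/-- Connectedness in terms of colourings agrees with connectedness in terms of
paths. -/
lemma isConnected_restrict_toGraph_iff (N : Network) (S : Set N.E) (A : N.E → Bool)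
    (hA : ∀ e, A e = true ↔ e ∈ S) :
    IsConnected (N.toGraph.restrict S) ↔ N.Good False A := by
  have hadj : ∀ e ∈ S, (N.toGraph.restrict S).Adj (N.fst e) (N.snd e) := fun e he =>
    ⟨e, by simpa [Graph.restrict] using ⟨he, Or.inl ⟨rfl, rfl⟩⟩⟩
  constructor
  · rintro ⟨-, h⟩ c hc - v
    have key : ∀ x y, Relation.ReflTransGen (N.toGraph.restrict S).Adj x y → (c x ↔ c y) := by
      intro x y hxy
      induction hxy with
      | refl => exact Iff.rfl
      | @tail b d _ h ih =>
        obtain ⟨e, he⟩ := h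
        have he' : e ∈ S ∧ N.toGraph.IsLink e b d := by simpa [Graph.restrict, and_comm] using he
        obtain ⟨hS, ⟨rfl, rfl⟩ | ⟨rfl, rfl⟩⟩ := he'
        · exact ih.trans (hc e ((hA e).2 hS))
        · exact ih.trans (hc e ((hA e).2 hS)).symm
    exact key _ _ (h v (Set.mem_univ _) _ (Set.mem_univ _))
  · intro h
    refine ⟨⟨.inl false, Set.mem_univ _⟩, fun x _ y _ => ?_⟩
    have h1 := h (fun v => Relation.ReflTransGen (N.toGraph.restrict S).Adj x v) (by
      intro e he
      have := hadj e ((hA e).1 he)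
      exact ⟨fun h => h.tail this, fun h => h.tail this.symm⟩) False.elim
    exact (h1 y).2 ((h1 x).1 Relation.ReflTransGen.refl)

lemma reliabilityPolynomial_toGraph_eval (N : Network) (hE : N.toGraph.edgeSet.Finite) (p : ℂ) :
    (reliabilityPolynomial N.toGraph hE).eval p = N.rel p := by
  classical
  have hfin : hE.toFinset = Finset.univ := by
    ext e; simp [show e ∈ N.toGraph.edgeSet from Set.mem_univ e]
  unfold reliabilityPolynomial rel stateSum
  rw [Polynomial.eval_finsetSum, Finset.sum_filter, hfin, Finset.powerset_univ]
  let φ : Finset N.E ≃ (N.E → Bool) :=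
    { toFun := fun S e => decide (e ∈ S)
      invFun := fun A => Finset.univ.filter fun e => A e = true
      left_inv := fun S => by ext; simp
      right_inv := fun A => by funext e; simp }
  refine Fintype.sum_equiv φ _ _ fun S => ?_
  have hS := N.isConnected_restrict_toGraph_iff (S : Set N.E) (φ S) (by simp [φ])
  by_cases h : N.Good False (φ S)
  · rw [if_pos h, if_pos (hS.2 h)]
    have : ∀ e, (φ S e = true) = (e ∈ S) := by simp [φ]
    simp only [this, Finset.prod_ite, Finset.prod_const]
    simp [Finset.filter_not, Finset.card_sdiff]
  · rw [if_neg h, if_neg (fun h' => h (hS.1 h'))]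

/-- A zero of `rel` of a connected network is a reliability zero. -/
lemma mem_reliabilityZeros (N : Network) (hN : N.Good False fun _ => true) {p : ℂ}
    (hp : N.rel p = 0) : p ∈ reliabilityZeros := by
  have hE : N.toGraph.edgeSet.Finite := Set.toFinite _
  refine ⟨_, _, N.toGraph, Set.toFinite _, hE, ?_, ?_⟩
  · rw [← Graph.restrict_self N.toGraph]
    exact (N.isConnected_restrict_toGraph_iff _ _ fun e =>
      iff_of_true rfl (Set.mem_univ e)).2 hN
  · rw [reliabilityPolynomial_toGraph_eval, hp]

end Network

/-! ### Component recursions -/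

/-- If the weights of each edge add up to `1`, properties depending on disjoint sets of edges are
independent. -/
lemma stateSum_and_eq_mul {E : Type} [Fintype E] (x : E → ℂ) (F : E → Prop)
    (P Q : (E → Bool) → Prop)
    (hP : ∀ A A' : E → Bool, (∀ e, F e → A e = A' e) → P A → P A')
    (hQ : ∀ A A' : E → Bool, (∀ e, ¬ F e → A e = A' e) → Q A → Q A') :
    stateSum (fun e => 1 - x e) x (fun A => P A ∧ Q A) =
      stateSum (fun e => 1 - x e) x P * stateSum (fun e => 1 - x e) x Q := by
  classical
  let φ := Equiv.piEquivPiSubtypeProd F (fun _ : E => Bool)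
  let ω : (E → Bool) → ℂ := fun A => ∏ e, if A e then 1 - x e else x e
  let ω₁ : ({e // F e} → Bool) → ℂ := fun A => ∏ e : {e // F e}, if A e then 1 - x e else x e
  let ω₂ : ({e // ¬ F e} → Bool) → ℂ := fun A => ∏ e : {e // ¬ F e}, if A e then 1 - x e else x e
  have hω : ∀ A, ω (φ.symm A) = ω₁ A.1 * ω₂ A.2 := by
    intro A
    rw [show ω (φ.symm A) = _ from (Fintype.prod_subtype_mul_prod_subtype F _).symm]
    congr 1
    · refine Finset.prod_congr rfl fun e _ => ?_
      simp [φ, Equiv.piEquivPiSubtypeProd, e.2]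
    · refine Finset.prod_congr rfl fun e _ => ?_
      simp [φ, Equiv.piEquivPiSubtypeProd, e.2]
  have h1 : ∑ A, ω₁ A = 1 := by
    have := stateSum_true (fun e : {e // F e} => 1 - x e) (fun e => x e)
    simp only [sub_add_cancel, Finset.prod_const_one] at this
    rw [← this]
    unfold stateSum
    simp only [if_true]
    exact Finset.sum_congr (by ext; simp) fun _ _ => rfl
  have h2 : ∑ A, ω₂ A = 1 := by
    have := stateSum_true (fun e : {e // ¬ F e} => 1 - x e) (fun e => x e)
    simp only [sub_add_cancel, Finset.prod_const_one] at this
    rw [← this]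
    unfold stateSum
    simp only [if_true]
    exact Finset.sum_congr (by ext; simp) fun _ _ => rfl
  let P₁ : ({e // F e} → Bool) → Prop := fun A => P (φ.symm (A, fun _ => false))
  let Q₁ : ({e // ¬ F e} → Bool) → Prop := fun A => Q (φ.symm (fun _ => false, A))
  have hP₁ : ∀ A, P (φ.symm A) ↔ P₁ A.1 := by
    intro A
    constructor <;> refine hP _ _ fun e he => ?_ <;>
      simp [φ, Equiv.piEquivPiSubtypeProd, he]
  have hQ₁ : ∀ A, Q (φ.symm A) ↔ Q₁ A.2 := by
    intro A
    constructor <;> refine hQ _ _ fun e he => ?_ <;>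
      simp [φ, Equiv.piEquivPiSubtypeProd, he]
  have hsum : ∀ R : (E → Bool) → Prop, stateSum (fun e => 1 - x e) x R =
      ∑ A₁, ∑ A₂, if R (φ.symm (A₁, A₂)) then ω₁ A₁ * ω₂ A₂ else 0 := by
    intro R
    rw [← Fintype.sum_prod_type' (f := fun A₁ A₂ =>
      if R (φ.symm (A₁, A₂)) then ω₁ A₁ * ω₂ A₂ else 0), ← φ.sum_comp]
    unfold stateSum
    refine Finset.sum_congr (by ext; simp) fun A _ => ?_
    rw [← hω]
    simp only [Prod.mk.eta, Equiv.symm_apply_apply]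
    rfl
  rw [hsum, hsum, hsum]
  simp only [hP₁, hQ₁]
  have e1 : (∑ A₁, ∑ A₂, if P₁ A₁ then ω₁ A₁ * ω₂ A₂ else 0) =
      ∑ A₁, if P₁ A₁ then ω₁ A₁ else 0 := by
    refine Finset.sum_congr rfl fun A₁ _ => ?_
    split_ifs
    · rw [← Finset.mul_sum, h2, mul_one]
    · simp
  have e2 : (∑ A₁, ∑ A₂, if Q₁ A₂ then ω₁ A₁ * ω₂ A₂ else 0) =
      ∑ A₂, if Q₁ A₂ then ω₂ A₂ else 0 := by
    rw [Finset.sum_comm]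
    refine Finset.sum_congr rfl fun A₂ _ => ?_
    split_ifs
    · rw [← Finset.sum_mul, h1, one_mul]
    · simp
  rw [e1, e2, Finset.sum_mul_sum]
  refine Finset.sum_congr rfl fun A₁ _ => Finset.sum_congr rfl fun A₂ _ => ?_
  by_cases hp : P₁ A₁ <;> by_cases hq : Q₁ A₂ <;> simp [hp, hq]

/-- A state sum splits along a partition of the edge sets with property `Q` into classes `P k`. -/
lemma stateSum_eq_sum {E κ : Type} [Fintype E] (a b : E → ℂ) (s : Finset κ)
    (Q : (E → Bool) → Prop) (P : κ → (E → Bool) → Prop)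
    (h : ∀ A, Q A → ∃ k ∈ s, P k A) (hQ : ∀ A, ∀ k ∈ s, P k A → Q A)
    (huniq : ∀ A, ∀ k ∈ s, ∀ l ∈ s, P k A → P l A → k = l) :
    stateSum a b Q = ∑ k ∈ s, stateSum a b (P k) := by
  classical
  unfold stateSum
  rw [Finset.sum_comm]
  refine Finset.sum_congr rfl fun A _ => ?_
  by_cases hA : Q A
  · obtain ⟨k, hk, hkA⟩ := h A hA
    rw [Finset.sum_eq_single k, if_pos hA, if_pos hkA]
    · intro l hl hlk
      rw [if_neg fun hlA => hlk (huniq A l hl k hk hlA hkA)]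
    · exact fun h => absurd hk h
  · rw [if_neg hA, Finset.sum_eq_zero]
    intro k hk
    rw [if_neg fun hkA => hA (hQ A k hk hkA)]

section Multigraph

variable {V E : Type} (f g : E → V)

/-- In the multigraph with vertices `V` in which the edge `e` has the ends `f e` and `g e`, the
edges from `A` within `K` connect the vertex set `K`. -/
def ConnectedOn (K : Set V) (A : E → Bool) : Prop :=
  ∀ c : V → Prop, (∀ e, A e = true → f e ∈ K → g e ∈ K → (c (f e) ↔ c (g e))) →
    ∀ u ∈ K, ∀ v ∈ K, c u → c v

/-- The edge `e` joins the vertex sets `K` and `L`. -/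
def Crosses (K L : Set V) (e : E) : Prop := (f e ∈ K ∧ g e ∈ L) ∨ (g e ∈ K ∧ f e ∈ L)

/-- The probability that the vertex set `K` is connected by edges within `K`, if the edge `e` fails
with "probability" `x e`. -/
noncomputable def relOn [Fintype E] (x : E → ℂ) (K : Set V) : ℂ :=
  stateSum (fun e => 1 - x e) x (ConnectedOn f g K)

open Classical in
/-- The product of the weights of the edges that join `K` and `L`. -/
noncomputable def cutWeight [Fintype E] (x : E → ℂ) (K L : Set V) : ℂ :=
  ∏ e, if Crosses f g K L e then x e else 1

variable {f g}

lemma ConnectedOn.congr {K : Set V} {A A' : E → Bool}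
    (hA : ∀ e, f e ∈ K → g e ∈ K → A e = A' e) (h : ConnectedOn f g K A) :
    ConnectedOn f g K A' :=
  fun c hc => h c fun e he h1 h2 => hc e (hA e h1 h2 ▸ he) h1 h2

lemma stateSum_not_crosses [Fintype E] (x : E → ℂ) (K L : Set V) :
    stateSum (fun e => 1 - x e) x (fun A => ∀ e, Crosses f g K L e → A e = false) =
      cutWeight f g x K L := by
  classical
  have h : cutWeight f g x K L = ∏ e, ((if Crosses f g K L e then 0 else 1 - x e) + x e) := by
    refine Finset.prod_congr rfl fun e _ => ?_
    split_ifs <;> ring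
  rw [h, ← stateSum_true]
  unfold stateSum
  refine Finset.sum_congr rfl fun A _ => ?_
  rw [if_pos trivial]
  split_ifs with hA
  · refine Finset.prod_congr rfl fun e _ => ?_
    by_cases he : Crosses f g K L e
    · simp [hA e he]
    · simp [he]
  · push Not at hA
    obtain ⟨e, he, hAe⟩ := hA
    refine (Finset.prod_eq_zero (Finset.mem_univ e) ?_).symm
    simp [he, hAe]

lemma stateSum_connectedOn_and [Fintype E] (x : E → ℂ) {K L : Set V} (hKL : Disjoint K L) :
    stateSum (fun e => 1 - x e) x
        (fun A => ConnectedOn f g K A ∧ ∀ e, Crosses f g K L e → A e = false) =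
      relOn f g x K * cutWeight f g x K L := by
  rw [stateSum_and_eq_mul x (fun e => f e ∈ K ∧ g e ∈ K), stateSum_not_crosses, relOn]
  · exact fun A A' h hA => hA.congr fun e h1 h2 => h e ⟨h1, h2⟩
  · intro A A' h hA e he
    rw [← h e, hA e he]
    rintro ⟨h1, h2⟩
    rcases he with he | he
    · exact Set.disjoint_left.1 hKL h2 he.2
    · exact Set.disjoint_left.1 hKL h1 he.2

lemma stateSum_connectedOn_and_connectedOn_and [Fintype E] (x : E → ℂ) {K L : Set V}
    (hKL : Disjoint K L) :
    stateSum (fun e => 1 - x e) x (fun A => ConnectedOn f g L A ∧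
        ConnectedOn f g K A ∧ ∀ e, Crosses f g K L e → A e = false) =
      relOn f g x L * (relOn f g x K * cutWeight f g x K L) := by
  rw [stateSum_and_eq_mul x (fun e => f e ∈ L ∧ g e ∈ L), stateSum_connectedOn_and x hKL]
  · rfl
  · exact fun A A' h hA => hA.congr fun e h1 h2 => h e ⟨h1, h2⟩
  · rintro A A' h ⟨hA, hA'⟩
    have key : ∀ e, f e ∈ K ∨ g e ∈ K → A e = A' e := by
      refine fun e he => h e ?_
      rintro ⟨h1, h2⟩
      rcases he with he | he
      · exact Set.disjoint_left.1 hKL he h1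
      · exact Set.disjoint_left.1 hKL he h2
    refine ⟨hA.congr fun e h1 _ => key e (Or.inl h1), fun e he => ?_⟩
    rw [← key e (he.imp And.left And.left), hA' e he]

/-- Sorting the edge sets by the vertex set of the component of a root `r`, inside the vertex set
consisting of `r` and the image of `U`. -/
lemma sum_relOn_mul_cutWeight [Fintype E] {W : Type} [DecidableEq W] (x : E → ℂ) (r : V)
    (ι : W → V) (hι : Function.Injective ι) (hr : ∀ w, ι w ≠ r) (U : Finset W) :
    ∑ K ∈ U.powerset, relOn f g x (insert r (ι '' K)) *
      cutWeight f g x (insert r (ι '' K)) (ι '' ↑(U \ K)) = 1 := by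
  classical
  have hmem : ∀ (K : Finset W) (w : W), ι w ∈ insert r (ι '' (K : Set W)) ↔ w ∈ K := by
    intro K w
    simp [hr w, hι.eq_iff]
  have hdisj : ∀ K : Finset W, Disjoint (insert r (ι '' (K : Set W))) (ι '' ↑(U \ K)) := by
    intro K
    rw [Set.disjoint_right]
    rintro _ ⟨w, hw, rfl⟩ h
    have := (hmem K w).1 h
    simp [this] at hw
  have hsub : ∀ K ⊆ U, ∀ v ∈ insert r (ι '' (U : Set W)), v ∉ insert r (ι '' (K : Set W)) →
      v ∈ ι '' (↑(U \ K) : Set W) := by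
    rintro K - v (rfl | ⟨w, hw, rfl⟩) hv
    · exact absurd (Set.mem_insert _ _) hv
    · exact ⟨w, by simpa using ⟨hw, fun h => hv ((hmem K w).2 h)⟩, rfl⟩
  simp_rw [← stateSum_connectedOn_and x (hdisj _)]
  rw [← stateSum_eq_sum _ _ _ (fun _ => True), stateSum_true]
  · simp
  · intro A _
    let compat : (V → Prop) → Prop := fun c => ∀ e, A e = true →
      f e ∈ insert r (ι '' (U : Set W)) → g e ∈ insert r (ι '' (U : Set W)) →
      (c (f e) ↔ c (g e))
    -- The component of `r` consists of the vertices that no compatible colouring separates from it.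
    let K : Finset W := U.filter fun w => ∀ c, compat c → c r → c (ι w)
    have hKU : K ⊆ U := Finset.filter_subset _ _
    have hK : ∀ v ∈ insert r (ι '' (K : Set W)), ∀ c, compat c → c r → c v := by
      rintro v (rfl | ⟨w, hw, rfl⟩) c hc hcr
      · exact hcr
      · exact (Finset.mem_filter.1 hw).2 c hc hcr
    have hins : ∀ v ∈ insert r (ι '' (K : Set W)), v ∈ insert r (ι '' (U : Set W)) :=
      fun v hv => Set.insert_subset_insert (Set.image_mono (by exact_mod_cast hKU)) hv
    have hcross : ∀ e, Crosses f g (insert r (ι '' (K : Set W))) (ι '' ↑(U \ K)) e →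
        A e = false := by
      intro e he
      by_contra hA
      rw [Bool.not_eq_false] at hA
      rcases he with ⟨h1, w, hw, h2⟩ | ⟨h1, w, hw, h2⟩ <;>
      · obtain ⟨hwU, hwK⟩ : w ∈ U ∧ w ∉ K := by simpa using hw
        refine hwK (Finset.mem_filter.2 ⟨hwU, fun c hc hcr => ?_⟩)
        have h3 := hK _ h1 c hc hcr
        have h4 : ι w ∈ insert r (ι '' (U : Set W)) := (hmem U w).2 hwU
        rw [h2] at h4 ⊢
        first
          | exact (hc e hA (hins _ h1) h4).1 h3
          | exact (hc e hA h4 (hins _ h1)).2 h3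
    refine ⟨K, Finset.mem_powerset.2 hKU, ?_, hcross⟩
    intro c hc
    have h1 : ∀ v ∈ insert r (ι '' (K : Set W)), c v ↔ c r := by
      intro v hv
      refine (hK v hv (fun v => v ∈ insert r (ι '' (K : Set W)) ∧ (c v ↔ c r)) ?_
        ⟨Set.mem_insert _ _, Iff.rfl⟩).2
      intro e he hf hg
      by_cases h1 : f e ∈ insert r (ι '' (K : Set W)) <;>
        by_cases h2 : g e ∈ insert r (ι '' (K : Set W))
      · have := hc e he h1 h2
        tauto
      · have := hcross e (Or.inl ⟨h1, hsub K hKU _ hg h2⟩)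
        simp [he] at this
      · have := hcross e (Or.inr ⟨h2, hsub K hKU _ hf h1⟩)
        simp [he] at this
      · tauto
    intro u hu v hv hcu
    exact (h1 v hv).2 ((h1 u hu).1 hcu)
  · exact fun _ _ _ _ => trivial
  -- A connected set that contains the root lies in every set that contains the root and has no
  -- crossing edges.
  · have key : ∀ A : E → Bool, ∀ K ⊆ U, ∀ L ⊆ U,
        ConnectedOn f g (insert r (ι '' (K : Set W))) A →
        (∀ e, Crosses f g (insert r (ι '' (L : Set W))) (ι '' ↑(U \ L)) e → A e = false) →
        K ⊆ L := by
      intro A K hK L hL hA hcross w hw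
      rw [← hmem]
      refine hA (fun v => v ∈ insert r (ι '' (L : Set W))) ?_ r (Set.mem_insert _ _) _
        ((hmem K w).2 hw) (Set.mem_insert _ _)
      intro e he hf hg
      have hins : ∀ v ∈ insert r (ι '' (K : Set W)), v ∈ insert r (ι '' (U : Set W)) :=
        fun v hv => Set.insert_subset_insert (Set.image_mono (by exact_mod_cast hK)) hv
      by_cases h1 : f e ∈ insert r (ι '' (L : Set W)) <;>
        by_cases h2 : g e ∈ insert r (ι '' (L : Set W))
      · exact iff_of_true h1 h2
      · have := hcross e (Or.inl ⟨h1, hsub L hL _ (hins _ hg) h2⟩)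
        simp [he] at this
      · have := hcross e (Or.inr ⟨h2, hsub L hL _ (hins _ hf) h1⟩)
        simp [he] at this
      · exact iff_of_false h1 h2
    intro A K hK L hL h1 h2
    rw [Finset.mem_powerset] at hK hL
    exact (key A K hK L hL h1.1 h2.2).antisymm (key A L hL K hK h2.1 h1.2)

end Multigraph

namespace Network

/-- The edge sets counted by `Split` sorted by the component of the first terminal. -/
lemma stateSum_split (N : Network) [DecidableEq N.W] (x : N.E → ℂ) :
    stateSum (fun e => 1 - x e) x N.Split = ∑ K : Finset N.W,
      relOn N.fst N.snd x (insert (.inl true) (Sum.inr '' ↑(Kᶜ))) *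
        (relOn N.fst N.snd x (insert (.inl false) (Sum.inr '' ↑K)) *
          cutWeight N.fst N.snd x (insert (.inl false) (Sum.inr '' ↑K))
            (insert (.inl true) (Sum.inr '' ↑(Kᶜ)))) := by
  classical
  have hS : ∀ (K : Finset N.W) (w : N.W),
      (.inr w : Bool ⊕ N.W) ∈ insert (.inl false) (Sum.inr '' (K : Set N.W)) ↔ w ∈ K := by simp
  have hdisj : ∀ K : Finset N.W, Disjoint (insert (.inl false) (Sum.inr '' (K : Set N.W)))
      (insert (.inl true : Bool ⊕ N.W) (Sum.inr '' (↑(Kᶜ) : Set N.W))) := by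
    intro K
    rw [Set.disjoint_left]
    rintro ((_ | _) | w) <;> simp
  have hcompl : ∀ (K : Finset N.W) (v : Bool ⊕ N.W),
      v ∈ insert (.inl true : Bool ⊕ N.W) (Sum.inr '' (↑(Kᶜ) : Set N.W)) ↔
      v ∉ insert (.inl false) (Sum.inr '' (K : Set N.W)) := by
    rintro K ((_ | _) | w) <;> simp
  have hcr : ∀ (K : Finset N.W) (A : N.E → Bool),
      (∀ e, Crosses N.fst N.snd (insert (.inl false) (Sum.inr '' (K : Set N.W)))
        (insert (.inl true) (Sum.inr '' (↑(Kᶜ) : Set N.W))) e → A e = false) ↔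
      ∀ e, A e = true → (N.fst e ∈ insert (.inl false) (Sum.inr '' (K : Set N.W)) ↔
        N.snd e ∈ insert (.inl false) (Sum.inr '' (K : Set N.W))) := by
    intro K A
    refine forall_congr' fun e => ?_
    rw [Crosses, hcompl, hcompl]
    by_cases h1 : N.fst e ∈ insert (.inl false) (Sum.inr '' (K : Set N.W)) <;>
      by_cases h2 : N.snd e ∈ insert (.inl false) (Sum.inr '' (K : Set N.W)) <;>
      cases A e <;> simp only [h1, h2] <;> simp
  simp_rw [← stateSum_connectedOn_and_connectedOn_and x (hdisj _)]
  refine stateSum_eq_sum _ _ _ _ _ ?_ ?_ ?_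
  · rintro A ⟨hT, hF⟩
    let compat : (Bool ⊕ N.W → Prop) → Prop := fun c =>
      ∀ e, A e = true → (c (N.fst e) ↔ c (N.snd e))
    let K : Finset N.W := Finset.univ.filter fun w => ∀ c, compat c → c (.inl false) → c (.inr w)
    have ht : ∃ c, compat c ∧ c (.inl false) ∧ ¬ c (.inl true) := by
      by_contra hcon
      push Not at hcon
      refine hF fun c hc _ => hT c hc fun _ => ⟨hcon c hc, fun h => ?_⟩
      by_contra h'
      exact hcon (fun v => ¬ c v) (fun e he => not_congr (hc e he)) h' h
    obtain ⟨c₀, hc₀, h₀, h₁⟩ := ht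
    -- `K` together with the first terminal is the component of that terminal.
    have hK : ∀ v, v ∈ insert (.inl false) (Sum.inr '' (K : Set N.W)) ↔
        ∀ c, compat c → c (.inl false) → c v := by
      rintro ((_ | _) | w)
      · simp
      · simpa using ⟨c₀, hc₀, h₀, h₁⟩
      · simp [K]
    have hcl : ∀ e, A e = true → (N.fst e ∈ insert (.inl false) (Sum.inr '' (K : Set N.W)) ↔
        N.snd e ∈ insert (.inl false) (Sum.inr '' (K : Set N.W))) := by
      intro e he
      rw [hK, hK]
      exact ⟨fun h c hc h0 => (hc e he).1 (h c hc h0), fun h c hc h0 => (hc e he).2 (h c hc h0)⟩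
    refine ⟨K, Finset.mem_univ _, ?_, ?_, (hcr K A).2 hcl⟩
    · intro c hc
      -- A colouring of the second component is extended to the first one by a constant.
      have h1 := hT (fun v => if v ∈ insert (.inl false) (Sum.inr '' (K : Set N.W))
        then c (.inl true) else c v) (by
          intro e he
          have h2 := hcl e he
          by_cases h3 : N.fst e ∈ insert (.inl false) (Sum.inr '' (K : Set N.W))
          · simp [h3, h2.1 h3]
          · have h4 : N.snd e ∉ insert (.inl false) (Sum.inr '' (K : Set N.W)) :=
              fun h => h3 (h2.2 h)
            rw [if_neg h3, if_neg h4]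
            exact hc e he ((hcompl K _).2 h3) ((hcompl K _).2 h4)) (by simp)
      have h5 : ∀ v ∈ insert (.inl true : Bool ⊕ N.W) (Sum.inr '' (↑(Kᶜ) : Set N.W)),
          c v ↔ c (.inl true) := by
        intro v hv
        have h6 := h1 v
        rw [hcompl] at hv
        rw [if_neg hv] at h6
        rw [h6]
        simp
      exact fun u hu v hv hcu => (h5 v hv).2 ((h5 u hu).1 hcu)
    · intro c hc
      have h5 : ∀ v ∈ insert (.inl false : Bool ⊕ N.W) (Sum.inr '' (K : Set N.W)),
          c v ↔ c (.inl false) := by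
        intro v hv
        refine ((hK v).1 hv (fun v => v ∈ insert (.inl false) (Sum.inr '' (K : Set N.W)) ∧
          (c v ↔ c (.inl false))) ?_ ⟨by simp, Iff.rfl⟩).2
        intro e he
        have h2 := hcl e he
        by_cases h3 : N.fst e ∈ insert (.inl false) (Sum.inr '' (K : Set N.W))
        · have := hc e he h3 (h2.1 h3)
          tauto
        · tauto
      exact fun u hu v hv hcu => (h5 v hv).2 ((h5 u hu).1 hcu)
  · rintro A K - ⟨h1, h2, h3⟩
    rw [hcr] at h3
    constructor
    · intro c hc hm v
      by_cases hv : v ∈ insert (.inl false) (Sum.inr '' (K : Set N.W))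
      · have := h2 c fun e he _ _ => hc e he
        exact ⟨this _ hv _ (by simp), this _ (by simp) _ hv⟩
      · have := h1 c fun e he _ _ => hc e he
        rw [← hcompl] at hv
        rw [hm trivial]
        exact ⟨this _ hv _ (by simp), this _ (by simp) _ hv⟩
    · intro h
      have := h _ h3 False.elim (.inl true)
      simp at this
  · have key : ∀ (A : N.E → Bool) (K L : Finset N.W),
        ConnectedOn N.fst N.snd (insert (.inl false) (Sum.inr '' (K : Set N.W))) A →
        (∀ e, A e = true → (N.fst e ∈ insert (.inl false) (Sum.inr '' (L : Set N.W)) ↔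
          N.snd e ∈ insert (.inl false) (Sum.inr '' (L : Set N.W)))) → K ⊆ L := by
      intro A K L h1 h2 w hw
      rw [← hS]
      exact h1 _ (fun e he _ _ => h2 e he) (.inl false) (by simp) _ ((hS K w).2 hw) (by simp)
    rintro A K - L - ⟨-, h1, h2⟩ ⟨-, h3, h4⟩
    rw [hcr] at h2 h4
    exact (key A K L h1 h4).antisymm (key A L K h3 h2)

/-- The vertex of the network with identified terminals that corresponds to a vertex of the
network; the identified terminals are `none`. -/
def mergeTerminals {W : Type} : Bool ⊕ W → Option W := Sum.elim (fun _ => none) some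

/-- Identifying the terminals turns `Good True` into connectedness of the whole vertex set. -/
lemma good_true_iff (N : Network) (A : N.E → Bool) :
    N.Good True A ↔ ConnectedOn (mergeTerminals ∘ N.fst) (mergeTerminals ∘ N.snd)
      (insert none (some '' Set.univ)) A := by
  have huniv : ∀ v : Option N.W, v ∈ insert none (some '' (Set.univ : Set N.W)) := by
    rintro (_ | w) <;> simp
  constructor
  · intro h c hc
    have h1 := h (c ∘ mergeTerminals) (fun e he => hc e he (huniv _) (huniv _))
      (fun _ => Iff.rfl)
    have h2 : ∀ v, c v ↔ c none := by
      rintro (_ | w)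
      · exact Iff.rfl
      · exact h1 (.inr w)
    exact fun u _ v _ hcu => (h2 v).2 ((h2 u).1 hcu)
  · intro h c hc hm
    have hm := hm trivial
    let d : Option N.W → Prop := fun v => v.elim (c (.inl false)) fun w => c (.inr w)
    have hd : ∀ v, d (mergeTerminals v) ↔ c v := by
      rintro ((_ | _) | w)
      · exact Iff.rfl
      · exact hm
      · exact Iff.rfl
    have h1 := h d fun e he _ _ => (hd _).trans ((hc e he).trans (hd _).symm)
    intro v
    rw [← hd v]
    exact ⟨h1 _ (huniv _) none (huniv _), h1 none (huniv _) _ (huniv _)⟩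

/-! ### Networks whose terminals are joined to all interior vertices -/

/-- The first ends of the edges of `doubleCone`. -/
def coneFst {W I : Type} (α : I → W) : (Bool × W) ⊕ I → Bool ⊕ W :=
  Sum.elim (fun x => .inl x.1) fun i => .inr (α i)

/-- The second ends of the edges of `doubleCone`. -/
def coneSnd {W I : Type} (β : I → W) : (Bool × W) ⊕ I → Bool ⊕ W :=
  Sum.elim (fun x => .inr x.2) fun i => .inr (β i)

/-- The network with interior vertices `W` in which each terminal is joined to each interior vertex
by one edge and the interior edge `i` has the ends `α i` and `β i`. -/
def doubleCone {W I : Type} [Fintype W] [Fintype I] (α β : I → W) : Network where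
  W := W
  E := (Bool × W) ⊕ I
  fst := coneFst α
  snd := coneSnd β

section doubleCone

variable {W I : Type} [Fintype W] [DecidableEq W] [Fintype I] (α β : I → W) (u : W → ℂ) (v : I → ℂ)

/-- The failure weights on the edges of `doubleCone` that give both edges between the terminals and
the interior vertex `w` the weight `u w`, and the interior edge `i` the weight `v i`. -/
def coneWeight {W I : Type} (u : W → ℂ) (v : I → ℂ) : (Bool × W) ⊕ I → ℂ :=
  Sum.elim (fun x => u x.2) v

/-- The recursion satisfied by the connection probabilities of the vertex sets consisting of a root
and a set of interior vertices, if `u w` is the failure weight of the edges from the root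
to `w`. -/
def IsRelOf (F : Finset W → ℂ) : Prop :=
  ∀ U : Finset W, ∑ K ∈ U.powerset, F K * ((∏ w ∈ U \ K, u w) * cutWeight α β v K ↑(U \ K)) = 1

lemma isRelOf_doubleCone (b : Bool) : IsRelOf α β u v fun K =>
    relOn (coneFst α) (coneSnd β) (coneWeight u v) (insert (.inl b) (Sum.inr '' (K : Set W))) := by
  classical
  intro U
  rw [← sum_relOn_mul_cutWeight (f := coneFst α) (g := coneSnd β) (coneWeight u v) (.inl b) Sum.inr
    Sum.inr_injective (by simp) U]
  refine Finset.sum_congr rfl fun K _ => ?_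
  congr 1
  unfold cutWeight
  rw [Fintype.prod_sum_type, Fintype.prod_prod_type, Fintype.prod_bool]
  congr 1
  · rw [← Finset.prod_mul_distrib, ← Fintype.prod_ite_mem]
    refine Finset.prod_congr rfl fun w _ => ?_
    cases b <;> simp [Crosses, coneFst, coneSnd, coneWeight]
  · simp [Crosses, coneFst, coneSnd, coneWeight]

/-- Identifying the terminals makes the two edges to an interior vertex parallel, which squares
their weight. -/
lemma isRelOf_mergeTerminals : IsRelOf α β (fun w => u w ^ 2) v fun K =>
    relOn (mergeTerminals ∘ coneFst α) (mergeTerminals ∘ coneSnd β) (coneWeight u v)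
      (insert none (some '' (K : Set W))) := by
  classical
  intro U
  rw [← sum_relOn_mul_cutWeight (f := mergeTerminals ∘ coneFst α) (g := mergeTerminals ∘ coneSnd β)
    (coneWeight u v) none some (Option.some_injective _) (by simp) U]
  refine Finset.sum_congr rfl fun K _ => ?_
  congr 1
  unfold cutWeight
  rw [Fintype.prod_sum_type, Fintype.prod_prod_type, Fintype.prod_bool]
  congr 1
  · rw [← Finset.prod_mul_distrib, ← Fintype.prod_ite_mem]
    refine Finset.prod_congr rfl fun w _ => ?_
    by_cases h : w ∈ U <;> by_cases h' : w ∈ K <;>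
      simp [Crosses, coneFst, coneSnd, coneWeight, mergeTerminals, h, h', sq]
  · simp [Crosses, coneFst, coneSnd, coneWeight, mergeTerminals]

lemma coneWeight_cutWeight (K : Finset W) :
    cutWeight (coneFst α) (coneSnd β) (coneWeight u v)
      (insert (.inl false) (Sum.inr '' (K : Set W)))
      (insert (.inl true) (Sum.inr '' (↑(Kᶜ) : Set W))) =
    (∏ w, u w) * cutWeight α β v K ↑(Kᶜ) := by
  classical
  unfold cutWeight
  rw [Fintype.prod_sum_type, Fintype.prod_prod_type, Fintype.prod_bool]
  congr 1
  · rw [← Finset.prod_mul_distrib]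
    refine Finset.prod_congr rfl fun w _ => ?_
    by_cases h : w ∈ K <;> simp [Crosses, coneFst, coneSnd, coneWeight, h]
  · simp [Crosses, coneFst, coneSnd, coneWeight]

/-- The recursion `IsRelOf` determines its solution, so this computes `merged`. -/
lemma doubleCone_stateSum_good_true : ∃ F, IsRelOf α β (fun w => u w ^ 2) v F ∧
    stateSum (fun e => 1 - coneWeight u v e) (coneWeight u v) ((doubleCone α β).Good True) =
      F Finset.univ := by
  refine ⟨_, isRelOf_mergeTerminals α β u v, stateSum_congr fun A => ?_⟩
  rw [Finset.coe_univ]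
  exact (doubleCone α β).good_true_iff A

lemma doubleCone_stateSum_split : ∃ F G, IsRelOf α β u v F ∧ IsRelOf α β u v G ∧
    stateSum (fun e => 1 - coneWeight u v e) (coneWeight u v) (doubleCone α β).Split =
      ∑ K, G (Kᶜ) * (F K * ((∏ w, u w) * cutWeight α β v K ↑(Kᶜ))) := by
  refine ⟨_, _, isRelOf_doubleCone α β u v false, isRelOf_doubleCone α β u v true, ?_⟩
  refine (@stateSum_split (doubleCone α β) ‹DecidableEq W› (coneWeight u v)).trans ?_
  exact Finset.sum_congr rfl fun K _ =>
    congrArg _ (congrArg _ (coneWeight_cutWeight α β u v K))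

end doubleCone

/-! ### A gadget on six vertices -/

/-- The first ends of the interior edges of the gadget, which form the complete graph on `Fin 4` in
the order `01, 02, 12, 03, 13, 23`. -/
def gadgetFst : Fin 6 → Fin 4 := ![0, 0, 1, 0, 1, 2]

/-- The second ends of the interior edges of the gadget. -/
def gadgetSnd : Fin 6 → Fin 4 := ![1, 2, 2, 3, 3, 3]

section gadget

/-- The product of the failure weights of the edges from `K` and the root to `L`. The edges from the
root have the weights `y` (to `0`, `1`, `2`) and `y'` (to `3`); the edges of the triangle `012` have
the weight `a`, the edges `03` and `13` the weight `b`, and the edge `23` the weight `c`. -/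
def gadgetWeight (y y' a b c : ℂ) (K L : Finset (Fin 4)) : ℂ :=
  (if 0 ∈ L then y else 1) * (if 1 ∈ L then y else 1) * (if 2 ∈ L then y else 1) *
    (if 3 ∈ L then y' else 1) *
  ((if (0 ∈ K ∧ 1 ∈ L) ∨ (1 ∈ K ∧ 0 ∈ L) then a else 1) *
    (if (0 ∈ K ∧ 2 ∈ L) ∨ (2 ∈ K ∧ 0 ∈ L) then a else 1) *
    (if (1 ∈ K ∧ 2 ∈ L) ∨ (2 ∈ K ∧ 1 ∈ L) then a else 1) *
    (if (0 ∈ K ∧ 3 ∈ L) ∨ (3 ∈ K ∧ 0 ∈ L) then b else 1) *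
    (if (1 ∈ K ∧ 3 ∈ L) ∨ (3 ∈ K ∧ 1 ∈ L) then b else 1) *
    (if (2 ∈ K ∧ 3 ∈ L) ∨ (3 ∈ K ∧ 2 ∈ L) then c else 1))

variable {y y' a b c : ℂ}

lemma gadgetWeight_eq (K L : Finset (Fin 4)) :
    (∏ w ∈ L, ![y, y, y, y'] w) *
      cutWeight gadgetFst gadgetSnd ![a, a, a, b, b, c] ↑K ↑L = gadgetWeight y y' a b c K L := by
  classical
  rw [← Fintype.prod_ite_mem, Fin.prod_univ_four, cutWeight, Fin.prod_univ_six]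
  simp [gadgetWeight, Crosses, gadgetFst, gadgetSnd]

lemma sum_powerset_singleton {α : Type} [DecidableEq α] (f : Finset α → ℂ) (i : α) :
    ∑ K ∈ ({i} : Finset α).powerset, f K = f ∅ + f {i} := by
  rw [← insert_empty_eq, Finset.sum_powerset_insert (by simp)]
  simp

lemma sum_powerset_pair {α : Type} [DecidableEq α] (f : Finset α → ℂ) {i j : α} (hij : i ≠ j) :
    ∑ K ∈ ({i, j} : Finset α).powerset, f K = f ∅ + f {j} + (f {i} + f {i, j}) := by
  rw [Finset.sum_powerset_insert (by simpa using hij), sum_powerset_singleton,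
    sum_powerset_singleton (fun K => f (insert i K))]
  simp

lemma sum_powerset_triple {α : Type} [DecidableEq α] (f : Finset α → ℂ) {i j k : α} (hij : i ≠ j)
    (hik : i ≠ k) (hjk : j ≠ k) :
    ∑ K ∈ ({i, j, k} : Finset α).powerset, f K = f ∅ + f {k} + (f {j} + f {j, k}) +
      (f {i} + f {i, k} + (f {i, j} + f {i, j, k})) := by
  rw [Finset.sum_powerset_insert (by simp [hij, hik]), sum_powerset_pair _ hjk,
    sum_powerset_pair (fun K => f (insert i K)) hjk]
  simp

lemma sum_powerset_quadruple {α : Type} [DecidableEq α] (f : Finset α → ℂ) {i j k l : α}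
    (hij : i ≠ j) (hik : i ≠ k) (hil : i ≠ l) (hjk : j ≠ k) (hjl : j ≠ l) (hkl : k ≠ l) :
    ∑ K ∈ ({i, j, k, l} : Finset α).powerset, f K = f ∅ + f {l} + (f {k} + f {k, l}) +
      (f {j} + f {j, l} + (f {j, k} + f {j, k, l})) +
      (f {i} + f {i, l} + (f {i, k} + f {i, k, l}) +
      (f {i, j} + f {i, j, l} + (f {i, j, k} + f {i, j, k, l}))) := by
  rw [Finset.sum_powerset_insert (by simp [hij, hik, hil]), sum_powerset_triple _ hjk hjl hkl,
    sum_powerset_triple (fun K => f (insert i K)) hjk hjl hkl]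
  simp

/-- The connection probabilities of the vertex sets of the gadget that contain a given root,
obtained by solving `IsRelOf` for one vertex set after the other. -/
lemma gadget_values {F : Finset (Fin 4) → ℂ}
    (hF : IsRelOf gadgetFst gadgetSnd ![y, y, y, y'] ![a, a, a, b, b, c] F) :
    F ∅ = 1 ∧
    F {0} = 1 - y ∧
    F {1} = 1 - y ∧
    F {0, 1} = 1 - 2*y*a - y^2 + 2*y^2*a ∧
    F {2} = 1 - y ∧
    F {0, 2} = 1 - 2*y*a - y^2 + 2*y^2*a ∧
    F {1, 2} = 1 - 2*y*a - y^2 + 2*y^2*a ∧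
    F {0, 1, 2} = 1 - 3*y*a^2 - 3*y^2*a^2 + 6*y^2*a^3 - y^3 + 6*y^3*a^2 - 6*y^3*a^3 ∧
    F {3} = 1 - y' ∧
    F {0, 3} = 1 - y'*b - y*b - y*y' + 2*y*y'*b ∧
    F {1, 3} = 1 - y'*b - y*b - y*y' + 2*y*y'*b ∧
    F {0, 1, 3} = 1 - y'*b^2 - 2*y*a*b - 2*y*y'*a*b + 4*y*y'*a*b^2 - y^2*b^2 + 2*y^2*a*b^2 - y^2*y'
      + 2*y^2*y'*b^2 + 4*y^2*y'*a*b - 6*y^2*y'*a*b^2 ∧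
    F {2, 3} = 1 - y'*c - y*c - y*y' + 2*y*y'*c ∧
    F {0, 2, 3} = 1 - y'*b*c - y*a*c - y*a*b - y*y'*a*c - y*y'*a*b + 4*y*y'*a*b*c - y^2*b*c +
      2*y^2*a*b*c - y^2*y' + 2*y^2*y'*b*c + 2*y^2*y'*a*c + 2*y^2*y'*a*b - 6*y^2*y'*a*b*c ∧
    F {1, 2, 3} = 1 - y'*b*c - y*a*c - y*a*b - y*y'*a*c - y*y'*a*b + 4*y*y'*a*b*c - y^2*b*c +
      2*y^2*a*b*c - y^2*y' + 2*y^2*y'*b*c + 2*y^2*y'*a*c + 2*y^2*y'*a*b - 6*y^2*y'*a*b*c ∧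
    F {0, 1, 2, 3} = 1 - y'*b^2*c - y*a^2*c - 2*y*a^2*b - 2*y*y'*a^2*b*c - y*y'*a^2*b^2 +
      6*y*y'*a^2*b^2*c - 2*y^2*a^2*b*c - y^2*a^2*b^2 + 4*y^2*a^3*b*c + 2*y^2*a^3*b^2 - y^2*y'*a^2*c
      - 2*y^2*y'*a^2*b + 6*y^2*y'*a^2*b^2*c + 8*y^2*y'*a^3*b*c + 4*y^2*y'*a^3*b^2 -
      18*y^2*y'*a^3*b^2*c - y^3*b^2*c + 6*y^3*a^2*b^2*c - 6*y^3*a^3*b^2*c - y^3*y' + 2*y^3*y'*b^2*c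
      + 2*y^3*y'*a^2*c + 4*y^3*y'*a^2*b + 4*y^3*y'*a^2*b*c + 2*y^3*y'*a^2*b^2 - 18*y^3*y'*a^2*b^2*c
      - 12*y^3*y'*a^3*b*c - 6*y^3*y'*a^3*b^2 + 24*y^3*y'*a^3*b^2*c := by
  have h : ∀ U : Finset (Fin 4), ∑ K ∈ U.powerset, F K * gadgetWeight y y' a b c K (U \ K) = 1 :=
    fun U => by simpa only [gadgetWeight_eq] using hF U
  have f : F ∅ = 1 := by
    have h' := h ∅
    simpa [gadgetWeight] using h'
  have f0 : F {0} = 1 - y := by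
    have h' := h {0}
    rw [sum_powerset_singleton] at h'
    simp [gadgetWeight] at h'
    simp only [f] at h'
    linear_combination h'
  have f1 : F {1} = 1 - y := by
    have h' := h {1}
    rw [sum_powerset_singleton] at h'
    simp [gadgetWeight] at h'
    simp only [f] at h'
    linear_combination h'
  have f01 : F {0, 1} = 1 - 2*y*a - y^2 + 2*y^2*a := by
    have h' := h {0, 1}
    rw [sum_powerset_pair (α := Fin 4) _ (i := 0) (j := 1) (by decide)] at h'
    simp [gadgetWeight] at h'
    simp only [f, f0, f1] at h'
    linear_combination h'
  have f2 : F {2} = 1 - y := by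
    have h' := h {2}
    rw [sum_powerset_singleton] at h'
    simp [gadgetWeight] at h'
    simp only [f] at h'
    linear_combination h'
  have f02 : F {0, 2} = 1 - 2*y*a - y^2 + 2*y^2*a := by
    have h' := h {0, 2}
    rw [sum_powerset_pair (α := Fin 4) _ (i := 0) (j := 2) (by decide)] at h'
    simp [gadgetWeight] at h'
    simp only [f, f0, f2] at h'
    linear_combination h'
  have f12 : F {1, 2} = 1 - 2*y*a - y^2 + 2*y^2*a := by
    have h' := h {1, 2}
    rw [sum_powerset_pair (α := Fin 4) _ (i := 1) (j := 2) (by decide)] at h'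
    simp [gadgetWeight] at h'
    simp only [f, f1, f2] at h'
    linear_combination h'
  have f012 : F {0, 1, 2} = 1 - 3*y*a^2 - 3*y^2*a^2 + 6*y^2*a^3 - y^3 + 6*y^3*a^2 - 6*y^3*a^3 := by
    have h' := h {0, 1, 2}
    rw [sum_powerset_triple (α := Fin 4) _ (i := 0) (j := 1) (k := 2) (by decide) (by decide)
      (by decide)] at h'
    simp [gadgetWeight] at h'
    simp only [f, f0, f1, f01, f2, f02, f12] at h'
    linear_combination h'
  have f3 : F {3} = 1 - y' := by
    have h' := h {3}
    rw [sum_powerset_singleton] at h'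
    simp [gadgetWeight] at h'
    simp only [f] at h'
    linear_combination h'
  have f03 : F {0, 3} = 1 - y'*b - y*b - y*y' + 2*y*y'*b := by
    have h' := h {0, 3}
    rw [sum_powerset_pair (α := Fin 4) _ (i := 0) (j := 3) (by decide)] at h'
    simp [gadgetWeight] at h'
    simp only [f, f0, f3] at h'
    linear_combination h'
  have f13 : F {1, 3} = 1 - y'*b - y*b - y*y' + 2*y*y'*b := by
    have h' := h {1, 3}
    rw [sum_powerset_pair (α := Fin 4) _ (i := 1) (j := 3) (by decide)] at h'
    simp [gadgetWeight] at h'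
    simp only [f, f1, f3] at h'
    linear_combination h'
  have f013 : F {0, 1, 3} = 1 - y'*b^2 - 2*y*a*b - 2*y*y'*a*b + 4*y*y'*a*b^2 - y^2*b^2 +
      2*y^2*a*b^2 - y^2*y' + 2*y^2*y'*b^2 + 4*y^2*y'*a*b - 6*y^2*y'*a*b^2 := by
    have h' := h {0, 1, 3}
    rw [sum_powerset_triple (α := Fin 4) _ (i := 0) (j := 1) (k := 3) (by decide) (by decide)
      (by decide)] at h'
    simp [gadgetWeight] at h'
    simp only [f, f0, f1, f01, f3, f03, f13] at h'
    linear_combination h'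
  have f23 : F {2, 3} = 1 - y'*c - y*c - y*y' + 2*y*y'*c := by
    have h' := h {2, 3}
    rw [sum_powerset_pair (α := Fin 4) _ (i := 2) (j := 3) (by decide)] at h'
    simp [gadgetWeight] at h'
    simp only [f, f2, f3] at h'
    linear_combination h'
  have f023 : F {0, 2, 3} = 1 - y'*b*c - y*a*c - y*a*b - y*y'*a*c - y*y'*a*b + 4*y*y'*a*b*c -
      y^2*b*c + 2*y^2*a*b*c - y^2*y' + 2*y^2*y'*b*c + 2*y^2*y'*a*c + 2*y^2*y'*a*b - 6*y^2*y'*a*b*c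
      := by
    have h' := h {0, 2, 3}
    rw [sum_powerset_triple (α := Fin 4) _ (i := 0) (j := 2) (k := 3) (by decide) (by decide)
      (by decide)] at h'
    simp [gadgetWeight] at h'
    simp only [f, f0, f2, f02, f3, f03, f23] at h'
    linear_combination h'
  have f123 : F {1, 2, 3} = 1 - y'*b*c - y*a*c - y*a*b - y*y'*a*c - y*y'*a*b + 4*y*y'*a*b*c -
      y^2*b*c + 2*y^2*a*b*c - y^2*y' + 2*y^2*y'*b*c + 2*y^2*y'*a*c + 2*y^2*y'*a*b - 6*y^2*y'*a*b*c
      := by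
    have h' := h {1, 2, 3}
    rw [sum_powerset_triple (α := Fin 4) _ (i := 1) (j := 2) (k := 3) (by decide) (by decide)
      (by decide)] at h'
    simp [gadgetWeight] at h'
    simp only [f, f1, f2, f12, f3, f13, f23] at h'
    linear_combination h'
  have f0123 : F {0, 1, 2, 3} = 1 - y'*b^2*c - y*a^2*c - 2*y*a^2*b - 2*y*y'*a^2*b*c - y*y'*a^2*b^2
      + 6*y*y'*a^2*b^2*c - 2*y^2*a^2*b*c - y^2*a^2*b^2 + 4*y^2*a^3*b*c + 2*y^2*a^3*b^2 -
      y^2*y'*a^2*c - 2*y^2*y'*a^2*b + 6*y^2*y'*a^2*b^2*c + 8*y^2*y'*a^3*b*c + 4*y^2*y'*a^3*b^2 -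
      18*y^2*y'*a^3*b^2*c - y^3*b^2*c + 6*y^3*a^2*b^2*c - 6*y^3*a^3*b^2*c - y^3*y' + 2*y^3*y'*b^2*c
      + 2*y^3*y'*a^2*c + 4*y^3*y'*a^2*b + 4*y^3*y'*a^2*b*c + 2*y^3*y'*a^2*b^2 - 18*y^3*y'*a^2*b^2*c
      - 12*y^3*y'*a^3*b*c - 6*y^3*y'*a^3*b^2 + 24*y^3*y'*a^3*b^2*c := by
    have h' := h {0, 1, 2, 3}
    rw [sum_powerset_quadruple (α := Fin 4) _ (i := 0) (j := 1) (k := 2) (l := 3) (by decide)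
      (by decide) (by decide) (by decide) (by decide) (by decide)] at h'
    simp [gadgetWeight] at h'
    simp only [f, f0, f1, f01, f2, f02, f12, f012, f3, f03, f13, f013, f23, f023, f123] at h'
    linear_combination h'
  exact ⟨f, f0, f1, f01, f2, f02, f12, f012, f3, f03, f13, f013, f23, f023, f123, f0123⟩

end gadget

/-! ### The gadget on the unit circle -/

/-- The value of `merged` for the gadget, if the terminals are joined to `0`, `1`, `2` by edges of
failure weight `z` and to `3` by edges of failure weight `z⁻¹`, and the interior edges have the
failure weights `z⁻¹` (triangle `012`), `z ^ 2` (edges `03`, `13`) and `z⁻¹ ^ 2` (edge `23`). -/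
lemma gadget_stateSum_good_true {z w : ℂ} (hzw : z * w = 1) :
    stateSum (fun e => 1 - coneWeight ![z, z, z, w] ![w, w, w, z ^ 2, z ^ 2, w ^ 2] e)
      (coneWeight ![z, z, z, w] ![w, w, w, z ^ 2, z ^ 2, w ^ 2])
      ((doubleCone gadgetFst gadgetSnd).Good True) =
    w ^ 2 * (1 - z) ^ 4 * (-4 - 8 * z + 6 * z ^ 3 - z ^ 4 - 4 * z ^ 5 - z ^ 6) := by
  obtain ⟨F, hF, h⟩ := doubleCone_stateSum_good_true gadgetFst gadgetSnd ![z, z, z, w]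
    ![w, w, w, z ^ 2, z ^ 2, w ^ 2]
  have hu : (fun i => (![z, z, z, w] : Fin 4 → ℂ) i ^ 2) = ![z ^ 2, z ^ 2, z ^ 2, w ^ 2] := by
    funext i; fin_cases i <;> rfl
  rw [hu] at hF
  obtain ⟨-, -, -, -, -, -, -, -, -, -, -, -, -, -, -, h15⟩ := gadget_values hF
  rw [h, show (Finset.univ : Finset (Fin 4)) = {0, 1, 2, 3} from rfl, h15]
  have hz : z ≠ 0 := left_ne_zero_of_mul_eq_one hzw
  obtain rfl : w = z⁻¹ := (inv_eq_of_mul_eq_one_right hzw).symm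
  field_simp
  ring

lemma gadget_cutWeight (a b c : ℂ) (K L : Finset (Fin 4)) :
    cutWeight gadgetFst gadgetSnd ![a, a, a, b, b, c] ↑K ↑L = gadgetWeight 1 1 a b c K L := by
  rw [← gadgetWeight_eq]
  have : ∏ w ∈ L, (![1, 1, 1, 1] : Fin 4 → ℂ) w = 1 :=
    Finset.prod_eq_one fun i _ => by fin_cases i <;> rfl
  rw [this, one_mul]

/-- The value of `split` for the gadget with the weights of `gadget_stateSum_good_true`. -/
lemma gadget_stateSum_split {z w : ℂ} (hzw : z * w = 1) :
    stateSum (fun e => 1 - coneWeight ![z, z, z, w] ![w, w, w, z ^ 2, z ^ 2, w ^ 2] e)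
      (coneWeight ![z, z, z, w] ![w, w, w, z ^ 2, z ^ 2, w ^ 2])
      (doubleCone gadgetFst gadgetSnd).Split =
    w ^ 2 * (1 - z) ^ 4 * (2 - 8 * z - 10 * z ^ 2 + 16 * z ^ 3 - 8 * z ^ 4 - 4 * z ^ 5) := by
  obtain ⟨F, G, hF, hG, h⟩ := doubleCone_stateSum_split gadgetFst gadgetSnd ![z, z, z, w]
    ![w, w, w, z ^ 2, z ^ 2, w ^ 2]
  obtain ⟨f0, f1, f2, f3, f4, f5, f6, f7, f8, f9, f10, f11, f12, f13, f14, f15⟩ := gadget_values hF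
  obtain ⟨g0, g1, g2, g3, g4, g5, g6, g7, g8, g9, g10, g11, g12, g13, g14, g15⟩ := gadget_values hG
  have hu : ∏ i, (![z, z, z, w] : Fin 4 → ℂ) i = z ^ 2 := by
    rw [Fin.prod_univ_four]
    change z * z * z * w = z ^ 2
    linear_combination z ^ 2 * hzw
  rw [h, hu, ← Finset.powerset_univ, show (Finset.univ : Finset (Fin 4)) = {0, 1, 2, 3} from rfl,
    sum_powerset_quadruple (α := Fin 4) _ (i := 0) (j := 1) (k := 2) (l := 3) (by decide)
      (by decide) (by decide) (by decide) (by decide) (by decide)]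
  simp only [gadget_cutWeight,
    show (∅ : Finset (Fin 4))ᶜ = {0, 1, 2, 3} from rfl,
    show ({0} : Finset (Fin 4))ᶜ = {1, 2, 3} from rfl,
    show ({1} : Finset (Fin 4))ᶜ = {0, 2, 3} from rfl,
    show ({2} : Finset (Fin 4))ᶜ = {0, 1, 3} from rfl,
    show ({3} : Finset (Fin 4))ᶜ = {0, 1, 2} from rfl,
    show ({0, 1} : Finset (Fin 4))ᶜ = {2, 3} from rfl,
    show ({0, 2} : Finset (Fin 4))ᶜ = {1, 3} from rfl,
    show ({0, 3} : Finset (Fin 4))ᶜ = {1, 2} from rfl,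
    show ({1, 2} : Finset (Fin 4))ᶜ = {0, 3} from rfl,
    show ({1, 3} : Finset (Fin 4))ᶜ = {0, 2} from rfl,
    show ({2, 3} : Finset (Fin 4))ᶜ = {0, 1} from rfl,
    show ({0, 1, 2} : Finset (Fin 4))ᶜ = {3} from rfl,
    show ({0, 1, 3} : Finset (Fin 4))ᶜ = {2} from rfl,
    show ({0, 2, 3} : Finset (Fin 4))ᶜ = {1} from rfl,
    show ({1, 2, 3} : Finset (Fin 4))ᶜ = {0} from rfl,
    show ({0, 1, 2, 3} : Finset (Fin 4))ᶜ = ∅ from rfl,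
    f0, f1, f2, f3, f4, f5, f6, f7, f8, f9, f10, f11, f12, f13, f14, f15,
    g0, g1, g2, g3, g4, g5, g6, g7, g8, g9, g10, g11, g12, g13, g14, g15]
  simp only [gadgetWeight]
  simp
  have hz : z ≠ 0 := left_ne_zero_of_mul_eq_one hzw
  obtain rfl : w = z⁻¹ := (inv_eq_of_mul_eq_one_right hzw).symm
  field_simp
  ring

lemma gadget_split_poly_pos {c : ℝ} (h1 : 309 / 1000 ≤ c) (h2 : c ≤ 77 / 100) :
    0 < 800 - 1280 * c - 784 * c ^ 2 + 1408 * c ^ 3 + 256 * c ^ 4 - 256 * c ^ 5 := by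
  have hu : 0 ≤ c - 309 / 1000 := by linarith
  have hv : 0 ≤ 77 / 100 - c := by linarith
  have h := fun i j : ℕ => mul_nonneg (pow_nonneg hu i) (pow_nonneg hv j)
  -- The Bernstein coefficients of the polynomial on this interval are positive.
  linarith [h 0 5, h 1 4, h 2 3, h 3 2, h 4 1, h 5 0]

lemma gadget_diff_poly_pos {c : ℝ} (h1 : 309 / 1000 ≤ c) (h2 : c ≤ 77 / 100) :
    0 < -115 + 430 * c + 17 * c ^ 2 - 636 * c ^ 3 - 16 * c ^ 4 + 256 * c ^ 5 + 64 * c ^ 6 := by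
  have hu : 0 ≤ c - 309 / 1000 := by linarith
  have hv : 0 ≤ 77 / 100 - c := by linarith
  have h := fun i j : ℕ => mul_nonneg (pow_nonneg hu i) (pow_nonneg hv j)
  -- The Bernstein coefficients of the polynomial on this interval are positive.
  linarith [h 0 6, h 1 5, h 2 4, h 3 3, h 4 2, h 5 1, h 6 0]

/-- On the arc of the unit circle between the angles `40°` and `72°` the gadget has
`|split| < |merged|`; the common factor of the two values is omitted. -/
lemma gadget_norm_lt {z : ℂ} (hz : ‖z‖ = 1) (h1 : 309 / 1000 ≤ z.re) (h2 : z.re ≤ 77 / 100) :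
    0 < ‖2 - 8 * z - 10 * z ^ 2 + 16 * z ^ 3 - 8 * z ^ 4 - 4 * z ^ 5‖ ∧
    ‖2 - 8 * z - 10 * z ^ 2 + 16 * z ^ 3 - 8 * z ^ 4 - 4 * z ^ 5‖ <
      ‖-4 - 8 * z + 6 * z ^ 3 - z ^ 4 - 4 * z ^ 5 - z ^ 6‖ := by
  have hzz : z * (starRingEnd ℂ) z = 1 := by rw [Complex.mul_conj', hz]; simp
  have hre : ((z.re : ℝ) : ℂ) = (z + (starRingEnd ℂ) z) / 2 := Complex.re_eq_add_conj z
  have hz0 : z ≠ 0 := left_ne_zero_of_mul_eq_one hzz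
  have hinv : (starRingEnd ℂ) z = z⁻¹ := (inv_eq_of_mul_eq_one_right hzz).symm
  -- Because `conj z = z⁻¹`, the squares of the norms are polynomials in `Re z`.
  have hs : ‖2 - 8 * z - 10 * z ^ 2 + 16 * z ^ 3 - 8 * z ^ 4 - 4 * z ^ 5‖ ^ 2 =
      800 - 1280 * z.re - 784 * z.re ^ 2 + 1408 * z.re ^ 3 + 256 * z.re ^ 4 - 256 * z.re ^ 5 := by
    apply Complex.ofReal_injective
    push_cast
    rw [← Complex.mul_conj', hre]
    simp only [map_sub, map_add, map_mul, map_pow, hinv, Complex.conj_ofNat]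
    field_simp
    ring
  have ht : ‖-4 - 8 * z + 6 * z ^ 3 - z ^ 4 - 4 * z ^ 5 - z ^ 6‖ ^ 2 -
      ‖2 - 8 * z - 10 * z ^ 2 + 16 * z ^ 3 - 8 * z ^ 4 - 4 * z ^ 5‖ ^ 2 =
      4 * (-115 + 430 * z.re + 17 * z.re ^ 2 - 636 * z.re ^ 3 - 16 * z.re ^ 4 + 256 * z.re ^ 5 +
        64 * z.re ^ 6) := by
    apply Complex.ofReal_injective
    push_cast
    rw [← Complex.mul_conj', ← Complex.mul_conj', hre]
    simp only [map_sub, map_add, map_mul, map_pow, map_neg, hinv, Complex.conj_ofNat]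
    field_simp
    ring
  have h3 := gadget_split_poly_pos h1 h2
  have h4 := gadget_diff_poly_pos h1 h2
  constructor
  · refine norm_pos_iff.2 fun h => ?_
    rw [h, norm_zero, zero_pow two_ne_zero] at hs
    linarith
  · refine lt_of_pow_lt_pow_left₀ 2 (norm_nonneg _) ?_
    linarith

/-! ### The gadget with multiple edges -/

lemma continuous_stateSum {E : Type} [Fintype E] (Q : (E → Bool) → Prop) :
    Continuous fun x : E → ℂ => stateSum (fun e => 1 - x e) x Q := by
  unfold stateSum
  refine continuous_finsetSum _ fun A _ => ?_
  split_ifs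
  · refine continuous_finsetProd _ fun e _ => ?_
    split_ifs <;> fun_prop
  · exact continuous_const

lemma continuous_coneWeight : Continuous fun zw : ℂ × ℂ =>
    (coneWeight ![zw.1, zw.1, zw.1, zw.2]
      ![zw.2, zw.2, zw.2, zw.1 ^ 2, zw.1 ^ 2, zw.2 ^ 2] : (Bool × Fin 4) ⊕ Fin 6 → ℂ) := by
  refine continuous_pi fun e => ?_
  rcases e with ⟨b, i⟩ | i <;> fin_cases i <;> simp [coneWeight] <;> fun_prop

/-- The gadget with each edge replaced by parallel edges: the numbers of parallel edges are such
that, for `i > 0`, an edge of failure weight `z ^ i` is replaced by `i * k` edges and one of failure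
weight `z ^ (-i)` by `i * m` edges. -/
def gadget (k m : ℕ) : Network :=
  (doubleCone gadgetFst gadgetSnd).subst fun e => dipole (Fin
    (Sum.elim (fun x => ![k, k, k, m] x.2) ![m, m, m, 2 * k, 2 * k, 2 * m] e))

lemma gadget_weight (k m : ℕ) (p : ℂ) (e : (Bool × Fin 4) ⊕ Fin 6) :
    p ^ (Sum.elim (fun x => ![k, k, k, m] x.2) ![m, m, m, 2 * k, 2 * k, 2 * m] e : ℕ) =
      coneWeight ![p ^ k, p ^ k, p ^ k, p ^ m]
        ![p ^ m, p ^ m, p ^ m, (p ^ k) ^ 2, (p ^ k) ^ 2, (p ^ m) ^ 2] e := by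
  rcases e with ⟨b, i⟩ | i <;> fin_cases i <;> simp [coneWeight, pow_mul']

/-- The value of `merged` for the gadget in terms of `z = p ^ k` and `w = p ^ m`. -/
noncomputable def gadgetMerged (x : ℂ × ℂ) : ℂ :=
  stateSum (fun e => 1 - coneWeight ![x.1, x.1, x.1, x.2]
      ![x.2, x.2, x.2, x.1 ^ 2, x.1 ^ 2, x.2 ^ 2] e)
    (coneWeight ![x.1, x.1, x.1, x.2] ![x.2, x.2, x.2, x.1 ^ 2, x.1 ^ 2, x.2 ^ 2])
    ((doubleCone gadgetFst gadgetSnd).Good True)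

/-- The value of `split` for the gadget in terms of `z = p ^ k` and `w = p ^ m`. -/
noncomputable def gadgetSplit (x : ℂ × ℂ) : ℂ :=
  stateSum (fun e => 1 - coneWeight ![x.1, x.1, x.1, x.2]
      ![x.2, x.2, x.2, x.1 ^ 2, x.1 ^ 2, x.2 ^ 2] e)
    (coneWeight ![x.1, x.1, x.1, x.2] ![x.2, x.2, x.2, x.1 ^ 2, x.1 ^ 2, x.2 ^ 2])
    (doubleCone gadgetFst gadgetSnd).Split

lemma continuous_gadgetMerged : Continuous gadgetMerged :=
  (continuous_stateSum _).comp continuous_coneWeight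

lemma continuous_gadgetSplit : Continuous gadgetSplit :=
  (continuous_stateSum _).comp continuous_coneWeight

lemma gadget_merged (k m : ℕ) (p : ℂ) :
    (gadget k m).merged p = gadgetMerged (p ^ k, p ^ m) := by
  refine (subst_merged _ _ p).trans ?_
  simp_rw [dipole_rel, dipole_split, Fintype.card_fin]
  unfold gadgetMerged
  congr 1
  · funext e
    exact congrArg (1 - ·) (gadget_weight k m p e)
  · funext e
    exact gadget_weight k m p e

lemma gadget_split (k m : ℕ) (p : ℂ) :
    (gadget k m).split p = gadgetSplit (p ^ k, p ^ m) := by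
  refine (subst_split _ _ p).trans ?_
  simp_rw [dipole_rel, dipole_split, Fintype.card_fin]
  unfold gadgetSplit
  congr 1
  · funext e
    exact congrArg (1 - ·) (gadget_weight k m p e)
  · funext e
    exact gadget_weight k m p e

end Network

/-! ### Powers of a point of the unit circle -/

/-- By recurrence of rotations, every integral power is a limit of powers with natural exponents. -/
lemma exists_pow_near_zpow {p : ℂ} (hp : ‖p‖ = 1) (j : ℤ) {U : Set ℂ} (hU : U ∈ nhds (p ^ j)) :
    ∃ k : ℕ, p ^ k ∈ U := by
  let P : Circle := ⟨p, by simpa [Submonoid.unitSphere] using hp⟩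
  have h := mapClusterPt_self_zpow_atTop_pow P j
  have hV : ((↑) : Circle → ℂ) ⁻¹' U ∈ nhds (P ^ j) := by
    refine continuous_subtype_val.continuousAt.preimage_mem_nhds ?_
    have : ((P ^ j : Circle) : ℂ) = p ^ j := Circle.coe_zpow P j
    rwa [← this] at hU
  obtain ⟨k, hk⟩ := (h.frequently hV).exists
  exact ⟨k, by simpa using hk⟩

lemma cos_two_pi_div_five : 309 / 1000 ≤ Real.cos (2 * Real.pi / 5) := by
  rw [show 2 * Real.pi / 5 = 2 * (Real.pi / 5) by ring, Real.cos_two_mul, Real.cos_pi_div_five]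
  have h5 : Real.sqrt 5 ^ 2 = 5 := Real.sq_sqrt (by norm_num)
  have h : 2.236 ≤ Real.sqrt 5 := Real.le_sqrt_of_sq_le (by norm_num)
  nlinarith

lemma cos_two_pi_div_nine : Real.cos (2 * Real.pi / 9) ≤ 77 / 100 := by
  have h3 : Real.cos (3 * (2 * Real.pi / 9)) = -1 / 2 := by
    rw [show 3 * (2 * Real.pi / 9) = Real.pi - Real.pi / 3 by ring, Real.cos_pi_sub,
      Real.cos_pi_div_three]
    norm_num
  rw [Real.cos_three_mul] at h3
  -- `4 * c ^ 3 - 3 * c > -1 / 2` for `c > 77 / 100`.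
  by_contra! h
  nlinarith [mul_pos (sub_pos.2 h) (sub_pos.2 h), pow_pos (sub_pos.2 h) 3]

/-- A point of the unit circle that is not a root of unity of order at most `4` has a power in the
arc between the angles `40°` and `72°`. -/
lemma exists_zpow_re_mem {p : ℂ} (hp : ‖p‖ = 1) (hpk : ∀ k : ℕ, 1 ≤ k → k ≤ 4 → p ^ k ≠ 1) :
    ∃ j : ℤ, 309 / 1000 ≤ (p ^ j).re ∧ (p ^ j).re ≤ 77 / 100 := by
  have hexp : ∀ j : ℤ, p ^ j = Complex.exp ((j * p.arg : ℝ) * Complex.I) := by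
    intro j
    have h := Complex.norm_mul_exp_arg_mul_I p
    rw [hp, Complex.ofReal_one, one_mul] at h
    conv_lhs => rw [← h]
    rw [← Complex.exp_int_mul]
    push_cast
    ring_nf
  have hre : ∀ j : ℤ, (p ^ j).re = Real.cos (j * p.arg) := by
    intro j
    rw [hexp, Complex.exp_ofReal_mul_I_re]
  -- The angles of the powers of `p` form a subgroup, which is dense or cyclic.
  let H : AddSubgroup ℝ := AddSubgroup.closure {p.arg, 2 * Real.pi}
  suffices h : ∃ x ∈ H, 2 * Real.pi / 9 ≤ x ∧ x ≤ 2 * Real.pi / 5 by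
    obtain ⟨x, hx, h1, h2⟩ := h
    obtain ⟨j, l, hjl⟩ := AddSubgroup.mem_closure_pair.1 hx
    have hpi := Real.pi_pos
    have hcos : (p ^ j).re = Real.cos x := by
      rw [hre, ← hjl, zsmul_eq_mul, zsmul_eq_mul, Real.cos_add_int_mul_two_pi]
    refine ⟨j, ?_, ?_⟩ <;> rw [hcos]
    · exact cos_two_pi_div_five.trans
        (Real.cos_le_cos_of_nonneg_of_le_pi (by linarith) (by linarith) h2)
    · exact (Real.cos_le_cos_of_nonneg_of_le_pi (by linarith) (by linarith) h1).trans
        cos_two_pi_div_nine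
  have hpi := Real.pi_pos
  rcases H.dense_or_cyclic with hd | ⟨a, ha⟩
  · obtain ⟨x, hxH, hx⟩ := hd.exists_mem_open (isOpen_Ioo (a := 2 * Real.pi / 9)
      (b := 2 * Real.pi / 5)) (Set.nonempty_Ioo.2 (by linarith))
    exact ⟨x, hxH, hx.1.le, hx.2.le⟩
  · have hmem : ∀ x, x ∈ H ↔ ∃ n : ℤ, n • a = x := fun x => by
      rw [ha, AddSubgroup.mem_closure_singleton]
    obtain ⟨n, hn⟩ := (hmem (2 * Real.pi)).1 (AddSubgroup.subset_closure (by simp))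
    obtain ⟨i, hi⟩ := (hmem p.arg).1 (AddSubgroup.subset_closure (by simp))
    rw [zsmul_eq_mul] at hn hi
    -- `H` is generated by `2 * π / N`, where `N` is the order of `p`.
    let N := n.natAbs
    have hN : (N : ℝ) * |a| = 2 * Real.pi := by
      rw [← abs_of_pos (by positivity : 0 < 2 * Real.pi), ← hn, abs_mul, Nat.cast_natAbs,
        Int.cast_abs]
    have haH : |a| ∈ H := by
      rcases abs_choice a with h | h
      · rw [h]; exact (hmem a).2 ⟨1, by simp⟩
      · rw [h]; exact (hmem _).2 ⟨-1, by simp⟩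
    have hN0 : N ≠ 0 := by
      intro h
      rw [h] at hN
      norm_num at hN
    have hpn : p ^ n = 1 := by
      rw [hexp, ← hi, Complex.exp_eq_one_iff]
      refine ⟨i, ?_⟩
      have hn' : (n : ℂ) * a = 2 * Real.pi := by exact_mod_cast hn
      push_cast
      linear_combination (i : ℂ) * Complex.I * hn'
    have hpN : p ^ N = 1 := by
      rcases Int.natAbs_eq n with h | h
      · rw [h, zpow_natCast] at hpn
        exact hpn
      · rw [h, zpow_neg, zpow_natCast, inv_eq_one] at hpn
        exact hpn
    have hN5 : 5 ≤ N := by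
      by_contra h
      exact hpk N (by omega) (by omega) hpN
    -- `N / 5` rounded down is at least `N / 9` for all `N ≥ 5`, with equality for `N = 9`.
    refine ⟨((N / 5 : ℕ) : ℝ) * |a|, ?_, ?_, ?_⟩
    · rw [← nsmul_eq_mul]
      exact H.nsmul_mem haH _
    · have : (N : ℝ) ≤ 9 * ((N / 5 : ℕ) : ℝ) := by
        exact_mod_cast (by omega : N ≤ 9 * (N / 5))
      nlinarith [abs_nonneg a]
    · have : 5 * ((N / 5 : ℕ) : ℝ) ≤ N := by
        exact_mod_cast (by omega : 5 * (N / 5) ≤ N)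
      nlinarith [abs_nonneg a]

namespace Network

/-- At a point of the unit circle that is not a root of unity of order at most `4`, some gadget has
`|split| < |merged|`. -/
lemma exists_gadget {p : ℂ} (hp : ‖p‖ = 1) (hpk : ∀ k : ℕ, 1 ≤ k → k ≤ 4 → p ^ k ≠ 1) :
    ∃ k m : ℕ, 0 < ‖(gadget k m).split p‖ ∧ ‖(gadget k m).split p‖ < ‖(gadget k m).merged p‖ := by
  obtain ⟨j, hj1, hj2⟩ := exists_zpow_re_mem hp hpk
  have hz : ‖p ^ j‖ = 1 := by rw [norm_zpow, hp, one_zpow]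
  have hzw : p ^ j * p ^ (-j) = 1 := by
    rw [zpow_neg, mul_inv_cancel₀]
    exact norm_ne_zero_iff.1 (by rw [hz]; exact one_ne_zero)
  have hopen : IsOpen {x | 0 < ‖gadgetSplit x‖ ∧ ‖gadgetSplit x‖ < ‖gadgetMerged x‖} :=
    (isOpen_lt continuous_const continuous_gadgetSplit.norm).inter
      (isOpen_lt continuous_gadgetSplit.norm continuous_gadgetMerged.norm)
  have hmem : (p ^ j, p ^ (-j)) ∈
      {x | 0 < ‖gadgetSplit x‖ ∧ ‖gadgetSplit x‖ < ‖gadgetMerged x‖} := by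
    generalize p ^ (-j) = w at hzw
    generalize p ^ j = z at *
    have h3 : w ^ 2 * (1 - z) ^ 4 ≠ 0 := by
      refine mul_ne_zero (pow_ne_zero _ (right_ne_zero_of_mul_eq_one hzw))
        (pow_ne_zero _ (sub_ne_zero.2 fun h => ?_))
      rw [← h, Complex.one_re] at hj2
      norm_num at hj2
    have h4 := gadget_norm_lt hz hj1 hj2
    have h5 := norm_pos_iff.2 h3
    have h1 : ‖gadgetSplit (z, w)‖ = ‖w ^ 2 * (1 - z) ^ 4‖ * _ :=
      (congrArg norm (gadget_stateSum_split hzw)).trans (norm_mul _ _)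
    have h2 : ‖gadgetMerged (z, w)‖ = ‖w ^ 2 * (1 - z) ^ 4‖ * _ :=
      (congrArg norm (gadget_stateSum_good_true hzw)).trans (norm_mul _ _)
    rw [Set.mem_ofPred_eq, h1, h2]
    exact ⟨mul_pos h5 h4.1, mul_lt_mul_of_pos_left h4.2 h5⟩
  obtain ⟨U, hU, V, hV, hUV⟩ := mem_nhds_prod_iff.1 (hopen.mem_nhds hmem)
  obtain ⟨k, hk⟩ := exists_pow_near_zpow hp j hU
  obtain ⟨m, hm⟩ := exists_pow_near_zpow hp (-j) hV
  refine ⟨k, m, ?_⟩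
  rw [gadget_merged, gadget_split]
  exact hUV (Set.mk_mem_prod hk hm)

/-! ### Two edges in series -/

/-- The path of length two between the terminals. -/
def path : Network where
  W := Unit
  E := Bool
  fst b := .inl b
  snd _ := .inr ()

lemma path_good_false_iff (A : Bool → Bool) : path.Good False A ↔ A = fun _ => true := by
  constructor
  · intro h
    by_contra hA
    obtain ⟨b, hb⟩ := Function.ne_iff.1 hA
    have h1 := h (fun v => v = .inl b) (fun e he => by
      have : e ≠ b := fun h => hb (h ▸ he)
      exact iff_of_false (fun h => this (Sum.inl_injective h)) Sum.inr_ne_inl) False.elim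
    have h2 := (h1 (.inr ())).trans (h1 (.inl b)).symm
    simp at h2
  · rintro rfl c hc -
    have h1 : ∀ b, c (.inl b) ↔ c (.inr ()) := fun b => hc b rfl
    rintro (b | ⟨⟩)
    · exact (h1 b).trans (h1 false).symm
    · exact (h1 false).symm

lemma path_good_true_iff (A : Bool → Bool) : path.Good True A ↔ ∃ e, A e = true := by
  constructor
  · intro h
    by_contra hA
    push Not at hA
    have h1 := h (fun v => v = .inr ()) (fun e he => absurd he (hA e)) (by simp) (.inr ())
    simp at h1
  · rintro ⟨e, he⟩ c hc hm
    have h1 : c (.inl e) ↔ c (.inr ()) := hc e he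
    have h2 := hm trivial
    rintro ((_ | _) | ⟨⟩)
    · exact Iff.rfl
    · exact h2.symm
    · cases e
      · exact h1.symm
      · exact h1.symm.trans h2.symm

lemma path_merged (p : ℂ) : path.merged p = 1 - p ^ 2 := by
  refine Eq.trans ?_ (dipole_rel Bool p)
  exact stateSum_congr fun A => (path_good_true_iff A).trans (dipole_good_false_iff Bool A).symm

lemma path_rel (p : ℂ) : path.rel p = (1 - p) ^ 2 := by
  refine (stateSum_congr path_good_false_iff).trans ?_
  unfold stateSum
  rw [Finset.sum_eq_single (fun _ => true)]
  · simp
  · intro A _ hA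
    rw [if_neg hA]
  · simp

lemma path_split (p : ℂ) : path.split p = 2 * p * (1 - p) := by
  have := path.rel_add_split p
  rw [path_rel, path_merged] at this
  linear_combination this

/-- On the unit circle, apart from `1` and `-1`, the path has `|merged| < |split|`. -/
lemma path_norm_lt {p : ℂ} (hp : ‖p‖ = 1) (h1 : p ≠ 1) (h2 : p ≠ -1) :
    0 < ‖path.merged p‖ ∧ ‖path.merged p‖ < ‖path.split p‖ := by
  have h3 : 1 - p ≠ 0 := sub_ne_zero.2 h1.symm
  have h4 : 1 + p ≠ 0 := fun h => h2 (eq_neg_of_add_eq_zero_right h)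
  have h5 : ‖1 + p‖ < 2 := by
    have hs : ¬ SameRay ℝ (1 : ℂ) p := by
      rw [sameRay_iff_of_norm_eq (by simp [hp])]
      exact h1.symm
    have := norm_add_lt_of_not_sameRay hs
    rw [hp, norm_one] at this
    linarith
  rw [path_merged, path_split, show 1 - p ^ 2 = (1 + p) * (1 - p) by ring]
  refine ⟨norm_pos_iff.2 (mul_ne_zero h4 h3), ?_⟩
  rw [norm_mul, norm_mul, norm_mul, hp, mul_one, Complex.norm_two]
  exact mul_lt_mul_of_pos_right h5 (norm_pos_iff.2 h3)

end Network

/-! ### Local logarithms and integer combinations -/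

open Filter Topology Metric

lemma exists_local_log {g : ℂ → ℂ} {p : ℂ} (hg : ∀ᶠ z in 𝓝 p, DifferentiableAt ℂ g z)
    (hp : g p ≠ 0) :
    ∃ l : ℂ → ℂ, ∀ᶠ z in 𝓝 p, DifferentiableAt ℂ l z ∧ Complex.exp (l z) = g z := by
  refine ⟨fun z => Complex.log (g z / g p) + Complex.log (g p), ?_⟩
  have hc : ContinuousAt (fun z => g z / g p) p :=
    hg.self_of_nhds.continuousAt.div_const _
  have hs : ∀ᶠ z in 𝓝 p, g z / g p ∈ Complex.slitPlane := by
    refine hc.eventually_mem (Complex.isOpen_slitPlane.mem_nhds ?_)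
    simp [div_self hp]
  filter_upwards [hg, hs] with z hz hz'
  refine ⟨((hz.div_const _).clog hz').add_const _, ?_⟩
  rw [Complex.exp_add, Complex.exp_log (Complex.slitPlane_ne_zero hz'), Complex.exp_log hp,
    div_mul_cancel₀ _ hp]

lemma re_eq_log_norm {w z : ℂ} (h : Complex.exp w = z) : w.re = Real.log ‖z‖ := by
  rw [← h, Complex.norm_exp, Real.log_exp]

/-- If a combination of holomorphic functions with nonnegative real coefficients has a nonzero
derivative at `p` and an imaginary value there, then near `p` there are points at which a
combination with natural coefficients takes a value in `2 * π * I * ℤ`. The coefficients are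
obtained by rounding large multiples of the real ones. -/
lemma frequently_nat_combination {ι : Type} [Fintype ι] {l : ι → ℂ → ℂ} {p : ℂ}
    (hl : ∀ᶠ z in 𝓝 p, ∀ i, DifferentiableAt ℂ (l i) z) {a : ι → ℝ} (ha : ∀ i, 0 ≤ a i)
    (hre : ∑ i, a i * (l i p).re = 0) (hD : ∑ i, (a i : ℂ) * deriv (l i) p ≠ 0) :
    ∃ᶠ z in 𝓝 p, ∃ n : ι → ℕ, (∀ i, 0 < a i → 0 < n i) ∧
      ∃ m : ℤ, ∑ i, (n i : ℂ) * l i z = m * (2 * Real.pi * Complex.I) := by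
  rw [frequently_iff]
  intro U hU
  have hcomb : ∀ b : ι → ℂ, ∀ z, (∀ i, DifferentiableAt ℂ (l i) z) →
      HasDerivAt (fun z => ∑ i, b i * l i z) (∑ i, b i * deriv (l i) z) z := fun b z hz =>
    HasDerivAt.fun_sum fun i _ => (hz i).hasDerivAt.const_mul (b i)
  have hne := (hcomb (fun i => a i) p hl.self_of_nhds).eventually_ne
    (c := ∑ i, (a i : ℂ) * l i p) hD
  rw [eventually_nhdsWithin_iff] at hne
  -- On a small circle around `p` the real combination stays away from its value at `p`.
  obtain ⟨R, hR, hRU⟩ := Metric.nhds_basis_closedBall.mem_iff.1 (hne.and (hl.and hU))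
  have hd : ∀ z ∈ closedBall p R, ∀ i, DifferentiableAt ℂ (l i) z := fun z hz => (hRU hz).2.1
  have hcont : ∀ b : ι → ℂ, ContinuousOn (fun z => ∑ i, b i * l i z) (closedBall p R) :=
    fun b z hz => (hcomb b z (hd z hz)).continuousAt.continuousWithinAt
  obtain ⟨κ, hκ, hκs⟩ : ∃ κ > 0, ∀ z ∈ sphere p R,
      κ ≤ ‖∑ i, (a i : ℂ) * l i z - ∑ i, (a i : ℂ) * l i p‖ := by
    obtain ⟨z, hz, hmin⟩ := (isCompact_sphere p R).exists_isMinOn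
      (NormedSpace.sphere_nonempty.2 hR.le)
      ((((hcont fun i => a i).mono sphere_subset_closedBall).sub
        (continuousOn_const (c := ∑ i, (a i : ℂ) * l i p))).norm)
    refine ⟨_, norm_pos_iff.2 (sub_ne_zero.2 ?_), fun w hw => hmin hw⟩
    exact (hRU (sphere_subset_closedBall hz)).1 (ne_of_mem_sphere hz hR.ne')
  have hbd : ∀ i, ∃ C, ∀ z ∈ closedBall p R, ‖l i z‖ ≤ C := fun i =>
    (isCompact_closedBall p R).exists_bound_of_continuousOn
      fun z hz => (hd z hz i).continuousAt.continuousWithinAt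
  choose C hC using hbd
  let M := ∑ i, C i
  let M' := ∑ i, ‖deriv (l i) p‖
  have hDpos := norm_pos_iff.2 hD
  obtain ⟨N, hN⟩ := exists_nat_gt (max 0 (max ((4 * M + 2 * Real.pi) / κ)
    (M' / ‖∑ i, (a i : ℂ) * deriv (l i) p‖)))
  obtain ⟨hN0, hN⟩ := max_lt_iff.1 hN
  obtain ⟨hN1, hN2⟩ := max_lt_iff.1 hN
  rw [div_lt_iff₀ hκ] at hN1
  rw [div_lt_iff₀ hDpos] at hN2
  let n : ι → ℕ := fun i => ⌈N * a i⌉₊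
  have hn : ∀ i, ‖(n i : ℂ) - N * a i‖ ≤ 1 := by
    intro i
    have h0 : 0 ≤ N * a i := mul_nonneg hN0.le (ha i)
    have h1 := Nat.le_ceil (N * a i)
    have h2 := Nat.ceil_lt_add_one h0
    have : (n i : ℂ) - N * a i = ((n i - N * a i : ℝ) : ℂ) := by push_cast; rfl
    rw [this, Complex.norm_real, Real.norm_eq_abs, abs_le]
    constructor <;> linarith
  -- Rounding changes the combinations by a bounded amount.
  have hround : ∀ v : ι → ℂ, ‖∑ i, (n i : ℂ) * v i - N * ∑ i, (a i : ℂ) * v i‖ ≤ ∑ i, ‖v i‖ := by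
    intro v
    have : ∑ i, (n i : ℂ) * v i - N * ∑ i, (a i : ℂ) * v i =
        ∑ i, ((n i : ℂ) - N * a i) * v i := by
      rw [Finset.mul_sum, ← Finset.sum_sub_distrib]
      exact Finset.sum_congr rfl fun i _ => by ring
    rw [this]
    refine norm_sum_le_of_le _ fun i _ => ?_
    rw [norm_mul]
    exact mul_le_of_le_one_left (norm_nonneg _) (hn i)
  have hroundM : ∀ z ∈ closedBall p R,
      ‖∑ i, (n i : ℂ) * l i z - N * ∑ i, (a i : ℂ) * l i z‖ ≤ M := fun z hz =>
    (hround fun i => l i z).trans (Finset.sum_le_sum fun i _ => hC i z hz)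
  have hpR : p ∈ closedBall p R := mem_closedBall_self hR.le
  have hdiff : DiffContOnCl ℂ (fun z => ∑ i, (n i : ℂ) * l i z) (ball p R) := by
    refine ⟨fun z hz => ?_, ?_⟩
    · exact (hcomb _ z (hd z (ball_subset_closedBall hz))).differentiableAt.differentiableWithinAt
    · rw [closure_ball p hR.ne']
      exact hcont _
  have hsphere : ∀ z ∈ sphere p R,
      N * κ - 2 * M ≤ ‖∑ i, (n i : ℂ) * l i z - ∑ i, (n i : ℂ) * l i p‖ := by
    intro z hz
    have h1 := hroundM z (sphere_subset_closedBall hz)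
    have h2 := hroundM p hpR
    have h3 : N * κ ≤ ‖(N : ℂ) * (∑ i, (a i : ℂ) * l i z - ∑ i, (a i : ℂ) * l i p)‖ := by
      rw [norm_mul, Complex.norm_natCast]
      exact mul_le_mul_of_nonneg_left (hκs z hz) hN0.le
    generalize (∑ i, (n i : ℂ) * l i z) = A at *
    generalize (∑ i, (n i : ℂ) * l i p) = B at *
    generalize (∑ i, (a i : ℂ) * l i z) = A' at *
    generalize (∑ i, (a i : ℂ) * l i p) = B' at *
    have h4 : (N : ℂ) * (A' - B') = (A - B) - (A - N * A') + (B - N * B') := by ring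
    rw [h4] at h3
    have h5 := norm_add_le ((A - B) - (A - N * A')) (B - N * B')
    have h6 := norm_sub_le (A - B) (A - N * A')
    linarith
  have hfreq : ∃ᶠ z in 𝓝 p, ∑ i, (n i : ℂ) * l i z ≠ ∑ i, (n i : ℂ) * l i p := by
    have hne0 : ∑ i, (n i : ℂ) * deriv (l i) p ≠ 0 := by
      intro h
      have h1 := hround fun i => deriv (l i) p
      rw [h, zero_sub, norm_neg, norm_mul, Complex.norm_natCast] at h1
      linarith
    exact ((hcomb (fun i => n i) p (hd p hpR)).eventually_ne hne0).frequently.filter_mono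
      nhdsWithin_le_nhds
  have himage := hdiff.ball_subset_image_closedBall hR hsphere hfreq
  let m : ℤ := round ((∑ i, (n i : ℂ) * l i p).im / (2 * Real.pi))
  have hpi := Real.pi_pos
  have hm : (m * (2 * Real.pi * Complex.I) : ℂ) ∈
      ball (∑ i, (n i : ℂ) * l i p) ((N * κ - 2 * M) / 2) := by
    rw [mem_ball, dist_comm, dist_eq_norm]
    have h1 : |(∑ i, (n i : ℂ) * l i p).re| ≤ M := by
      have h := (Complex.abs_re_le_norm _).trans (hroundM p hpR)
      have h0 : ((N : ℂ) * ∑ i, (a i : ℂ) * l i p).re = 0 := by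
        rw [← Complex.ofReal_natCast, Complex.re_ofReal_mul, Complex.re_sum]
        simp_rw [Complex.re_ofReal_mul]
        rw [hre, mul_zero]
      rwa [Complex.sub_re, h0, sub_zero] at h
    have h2 : |(∑ i, (n i : ℂ) * l i p).im - m * (2 * Real.pi)| ≤ Real.pi := by
      have h := abs_sub_round ((∑ i, (n i : ℂ) * l i p).im / (2 * Real.pi))
      have h3 : (∑ i, (n i : ℂ) * l i p).im - m * (2 * Real.pi) =
          ((∑ i, (n i : ℂ) * l i p).im / (2 * Real.pi) - m) * (2 * Real.pi) := by
        field_simp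
      rw [h3, abs_mul, abs_of_pos (by positivity : 0 < 2 * Real.pi)]
      nlinarith
    refine (Complex.norm_le_abs_re_add_abs_im _).trans_lt ?_
    simp only [Complex.sub_re, Complex.sub_im]
    have e1 : (m * (2 * Real.pi * Complex.I) : ℂ).re = 0 := by simp
    have e2 : (m * (2 * Real.pi * Complex.I) : ℂ).im = m * (2 * Real.pi) := by simp
    rw [e1, e2, sub_zero]
    linarith
  obtain ⟨z, hz, hzm⟩ := himage hm
  refine ⟨z, (hRU hz).2.2, n, fun i hi => Nat.ceil_pos.2 (mul_pos hN0 hi), m, hzm⟩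

/-- Real coefficients as required in `frequently_nat_combination`, for three functions whose values
at the point have real parts `l₁ < 0 < l₂` and `l₃`, and whose derivatives there are `L i`. -/
lemma exists_nonneg_combination {l : Fin 3 → ℝ} {L : Fin 3 → ℂ} (h0 : l 0 < 0) (h1 : 0 < l 1)
    (h : L 2 * l 0 - l 2 * L 0 ≠ 0) :
    ∃ a : Fin 3 → ℝ, (∀ i, 0 ≤ a i) ∧ 0 < a 1 ∧ ∑ i, a i * l i = 0 ∧ ∑ i, (a i : ℂ) * L i ≠ 0 := by
  by_cases hu : l 1 * L 0 - l 0 * L 1 = 0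
  · let s := |l 2 / l 0| / l 1 + 1
    have hs : 0 < s := by positivity
    have hs' : |l 2 / l 0| ≤ s * l 1 := by
      have : s * l 1 = |l 2 / l 0| + l 1 := by simp only [s]; field_simp
      linarith
    have h0' : (l 0 : ℂ) ≠ 0 := by exact_mod_cast h0.ne
    refine ⟨![s * l 1 - l 2 / l 0, s * -l 0, 1], ?_, ?_, ?_, ?_⟩
    · have := mul_pos hs (neg_pos.2 h0)
      have h3 := le_abs_self (l 2 / l 0)
      intro i
      fin_cases i <;> simp <;> linarith
    · exact mul_pos hs (neg_pos.2 h0)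
    · rw [Fin.sum_univ_three]
      simp
      have := h0.ne
      field_simp
      ring
    · rw [Fin.sum_univ_three]
      simp
      intro h4
      apply h
      have : (l 2 : ℂ) / l 0 * l 0 = l 2 := div_mul_cancel₀ _ h0'
      linear_combination l 0 * h4 - l 0 * s * hu + L 0 * this
  · refine ⟨![l 1, -l 0, 0], ?_, by simpa using h0, ?_, ?_⟩
    · intro i
      fin_cases i <;> simp <;> linarith
    · rw [Fin.sum_univ_three]
      simp
      ring
    · rw [Fin.sum_univ_three]
      simp
      intro h4
      apply hu
      linear_combination h4

/-! ### Accumulation of reliability zeros -/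

lemma differentiable_stateSum {E : Type} [Fintype E] (Q : (E → Bool) → Prop) :
    Differentiable ℂ fun p : ℂ => stateSum (fun _ : E => 1 - p) (fun _ => p) Q := by
  unfold stateSum
  refine Differentiable.fun_sum fun A _ => ?_
  split_ifs
  · intro p
    refine DifferentiableAt.fun_finsetProd fun e _ => ?_
    split_ifs <;> fun_prop
  · exact differentiable_const 0

namespace Network

lemma differentiable_merged (N : Network) : Differentiable ℂ N.merged := differentiable_stateSum _

lemma differentiable_split (N : Network) : Differentiable ℂ N.split := differentiable_stateSum _

/-- If the split ratios `split / merged` of three networks satisfy a multiplicative relation at `z`,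
then `z` is a reliability zero of the parallel composition of copies of these networks. The point
`p` serves only to guarantee that the composition is connected. -/
lemma mem_reliabilityZeros_of_prod_eq_one (N : Fin 3 → Network) {p z : ℂ}
    (hz : ∀ i, (N i).merged z ≠ 0) {n : Fin 3 → ℕ} {j : Fin 3} (hj : 0 < n j)
    (hp : ∀ i, (N i).merged p ≠ 0) (hpj : (N j).rel p ≠ 0)
    (h : ∏ i, ((N i).split z / (N i).merged z) ^ n i = 1) : z ∈ reliabilityZeros := by
  -- The composition contains `n i` copies of `N i`.
  let P : (Σ i, Fin (n i)) → Network := fun x => N x.1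
  refine mem_reliabilityZeros (parallel P)
    (parallel_good_false P (fun x => hp x.1) ⟨j, ⟨0, hj⟩⟩ hpj) ?_
  rw [rel_eq, parallel_merged, parallel_split]
  simp only [P, Fintype.prod_sigma, Finset.prod_const, Finset.card_univ, Fintype.card_fin]
  simp_rw [div_pow] at h
  rw [Finset.prod_div_distrib, div_eq_one_iff_eq
    (Finset.prod_ne_zero_iff.2 fun i _ => pow_ne_zero _ (hz i))] at h
  rw [h, sub_self]

/-- Density of the reliability zeros near a point of the unit circle. -/
lemma eventually_mem_closure_reliabilityZeros {p : ℂ} (hp : ‖p‖ = 1)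
    (hpk : ∀ k : ℕ, 1 ≤ k → k ≤ 4 → p ^ k ≠ 1) :
    ∀ᶠ z in 𝓝 p, z ∈ closure reliabilityZeros := by
  have hp1 : p ≠ 1 := by simpa using hpk 1 le_rfl (by norm_num)
  have hp2 : p ≠ -1 := fun h => hpk 2 (by norm_num) (by norm_num) (by rw [h]; norm_num)
  obtain ⟨k, m, hs0, hsm⟩ := exists_gadget hp hpk
  obtain ⟨hm0, hms⟩ := path_norm_lt hp hp1 hp2
  let N : Fin 3 → Network := ![gadget k m, path, dipole Unit]
  let g : Fin 3 → ℂ → ℂ := fun i z => (N i).split z / (N i).merged z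
  have hmerged : ∀ i, (N i).merged p ≠ 0 := by
    intro i
    fin_cases i
    · exact norm_pos_iff.1 (hs0.trans hsm)
    · exact norm_pos_iff.1 hm0
    · change (dipole Unit).merged p ≠ 0
      rw [dipole_merged]
      exact one_ne_zero
  have hsplit : ∀ i, (N i).split p ≠ 0 := by
    intro i
    fin_cases i
    · exact norm_pos_iff.1 hs0
    · exact norm_pos_iff.1 (hm0.trans hms)
    · change (dipole Unit).split p ≠ 0
      rw [dipole_split, Fintype.card_unit, pow_one]
      exact norm_pos_iff.1 (by rw [hp]; exact one_pos)
  have hrel : (N 1).rel p ≠ 0 := by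
    change path.rel p ≠ 0
    rw [path_rel]
    exact pow_ne_zero _ (sub_ne_zero.2 hp1.symm)
  have hev : ∀ i, ∀ᶠ z in 𝓝 p, (N i).merged z ≠ 0 := fun i =>
    (N i).differentiable_merged.continuous.continuousAt.eventually_ne (hmerged i)
  -- The logarithms of the ratios have real parts that are negative, positive and zero at `p`.
  have hlog : ∀ i, ∃ l : ℂ → ℂ,
      ∀ᶠ z in 𝓝 p, DifferentiableAt ℂ l z ∧ Complex.exp (l z) = g i z := fun i => by
    refine exists_local_log ?_ (div_ne_zero (hsplit i) (hmerged i))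
    filter_upwards [hev i] with z hz
    exact ((N i).differentiable_split z).div ((N i).differentiable_merged z) hz
  choose l hl using hlog
  have hl' : ∀ᶠ z in 𝓝 p, ∀ i, DifferentiableAt ℂ (l i) z ∧ Complex.exp (l i z) = g i z :=
    eventually_all.2 hl
  have hre : ∀ i, (l i p).re = Real.log ‖g i p‖ := fun i => re_eq_log_norm (hl i).self_of_nhds.2
  have h0 : (l 0 p).re < 0 := by
    rw [hre]
    change Real.log ‖(gadget k m).split p / (gadget k m).merged p‖ < 0
    rw [norm_div]
    exact Real.log_neg (div_pos hs0 (hs0.trans hsm)) ((div_lt_one (hs0.trans hsm)).2 hsm)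
  have h1 : 0 < (l 1 p).re := by
    rw [hre]
    change 0 < Real.log ‖path.split p / path.merged p‖
    rw [norm_div]
    exact Real.log_pos ((one_lt_div hm0).2 hms)
  have hg2 : g 2 = fun z => z := by
    funext z
    change (dipole Unit).split z / (dipole Unit).merged z = z
    rw [dipole_merged, dipole_split, Fintype.card_unit, pow_one, div_one]
  have h2 : (l 2 p).re = 0 := by
    rw [hre, hg2, hp, Real.log_one]
  have hd2 : deriv (l 2) p ≠ 0 := by
    intro h
    have h3 := (hl 2).self_of_nhds.1.hasDerivAt.cexp
    have h4 : (fun z => Complex.exp (l 2 z)) =ᶠ[𝓝 p] fun z => z :=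
      (hl 2).mono fun z hz => hz.2.trans (congrFun hg2 z)
    have h5 := h3.unique ((hasDerivAt_id' p).congr_of_eventuallyEq h4)
    rw [h, mul_zero] at h5
    exact zero_ne_one h5
  have hcl : ∀ i, ContinuousAt (l i) p := fun i => (hl i).self_of_nhds.1.continuousAt
  have hcd : ∀ i, ContinuousAt (deriv (l i)) p := fun i =>
    (Complex.analyticAt_iff_eventually_differentiableAt.2
      ((hl i).mono fun z hz => hz.1)).deriv.continuousAt
  have hcre : ∀ i, ContinuousAt (fun z => (l i z).re) p := fun i =>
    Complex.continuous_re.continuousAt.comp (hcl i)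
  have e0 : ∀ᶠ z in 𝓝 p, (l 0 z).re < 0 := (hcre 0).eventually_lt continuousAt_const h0
  have e1 : ∀ᶠ z in 𝓝 p, 0 < (l 1 z).re := continuousAt_const.eventually_lt (hcre 1) h1
  have e2 : ∀ᶠ z in 𝓝 p,
      deriv (l 2) z * ((l 0 z).re : ℂ) - ((l 2 z).re : ℂ) * deriv (l 0) z ≠ 0 := by
    refine ContinuousAt.eventually_ne (((hcd 2).mul ?_).sub (.mul ?_ (hcd 0))) ?_
    · exact Complex.continuous_ofReal.continuousAt.comp (hcre 0)
    · exact Complex.continuous_ofReal.continuousAt.comp (hcre 2)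
    · rw [h2, Complex.ofReal_zero, zero_mul, sub_zero]
      exact mul_ne_zero hd2 (by exact_mod_cast h0.ne)
  -- The conditions of `exists_nonneg_combination` hold at `p`, where the value of the third
  -- logarithm is imaginary, and by continuity near `p`.
  filter_upwards [e0, e1, e2, hl'.eventually_nhds, (eventually_all.2 hev).eventually_nhds]
    with q hq0 hq1 hq2 hql hqm
  obtain ⟨a, ha, ha1, hare, haD⟩ := exists_nonneg_combination (l := fun i => (l i q).re)
    (L := fun i => deriv (l i) q) hq0 hq1 hq2
  have hfreq := frequently_nat_combination (hql.mono fun z hz i => (hz i).1) ha hare haD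
  refine mem_closure_iff_frequently.2 ((hfreq.and_eventually (hql.and hqm)).mono ?_)
  rintro z ⟨⟨n, hn, j, hj⟩, hz, hzm⟩
  refine mem_reliabilityZeros_of_prod_eq_one N hzm (hn 1 ha1) hmerged hrel ?_
  rw [← (Complex.exp_eq_one_iff).2 ⟨j, hj⟩, Complex.exp_sum]
  refine Finset.prod_congr rfl fun i _ => ?_
  rw [Complex.exp_nat_mul, (hz i).2]

end Network

/-- The points of the unit circle that are not roots of unity of order at most `4` are dense. -/
lemma exists_norm_eq_one_near {q : ℂ} (hq : ‖q‖ = 1) {δ : ℝ} (hδ : 0 < δ) :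
    ∃ p : ℂ, ‖p‖ = 1 ∧ (∀ k : ℕ, 1 ≤ k → k ≤ 4 → p ^ k ≠ 1) ∧ ‖p - q‖ < δ := by
  let f : ℝ → ℂ := fun t => q * Complex.exp (t * Complex.I)
  have hf0 : f 0 = q := by simp [f]
  have hq0 : q ≠ 0 := norm_pos_iff.1 (by rw [hq]; exact one_pos)
  have hf : HasDerivAt f (q * Complex.I) 0 := by
    have h : HasDerivAt (fun t : ℝ => Complex.exp (t * Complex.I)) Complex.I 0 := by
      have := ((Complex.ofRealCLM.hasDerivAt (x := 0)).mul_const Complex.I).cexp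
      simpa using this
    exact h.const_mul q
  -- The derivative of `f ^ k` at `0` does not vanish, so `f t ^ k ≠ 1` for small `t ≠ 0`.
  have hne : ∀ k : ℕ, 1 ≤ k → ∀ᶠ t in 𝓝[≠] (0 : ℝ), f t ^ k ≠ 1 := fun k hk => by
    refine (hf.pow k).eventually_ne ?_
    rw [hf0]
    have : (k : ℂ) ≠ 0 := by exact_mod_cast (by omega : k ≠ 0)
    exact mul_ne_zero (mul_ne_zero this (pow_ne_zero _ hq0)) (mul_ne_zero hq0 Complex.I_ne_zero)
  have hball : ∀ᶠ t in 𝓝[≠] (0 : ℝ), f t ∈ Metric.ball q δ :=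
    nhdsWithin_le_nhds (hf.continuousAt.eventually_mem
      (by rw [hf0]; exact Metric.ball_mem_nhds q hδ))
  obtain ⟨t, ht1, ht2, ht3, ht4, ht⟩ := ((hne 1 le_rfl).and ((hne 2 (by norm_num)).and
    ((hne 3 (by norm_num)).and ((hne 4 (by norm_num)).and hball)))).exists
  refine ⟨f t, ?_, ?_, mem_ball_iff_norm.1 ht⟩
  · simp [f, hq, Complex.norm_exp_ofReal_mul_I]
  · intro k hk1 hk4
    interval_cases k <;> assumption

end Reliability

theorem mainTheorem3 :
    (∀ p : ℂ, ‖p‖ = 1 → (∀ k : ℕ, 1 ≤ k → k ≤ 4 → p ^ k ≠ 1) →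
      ∃ ε : ℝ, 0 < ε ∧ Metric.ball p ε ⊆ closure Reliability.reliabilityZeros) ∧
    (∀ q : ℂ, ‖q‖ = 1 → ∀ δ : ℝ, 0 < δ →
      ∃ z ∈ Reliability.reliabilityZeros, 1 < ‖z‖ ∧ ‖z / (‖z‖ : ℂ) - q‖ < δ) := by
  have key : ∀ p : ℂ, ‖p‖ = 1 → (∀ k : ℕ, 1 ≤ k → k ≤ 4 → p ^ k ≠ 1) →
      ∃ ε : ℝ, 0 < ε ∧ Metric.ball p ε ⊆ closure Reliability.reliabilityZeros :=
    fun p hp hpk => Metric.eventually_nhds_iff_ball.1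
      (Reliability.Network.eventually_mem_closure_reliabilityZeros hp hpk)
  refine ⟨key, fun q hq δ hδ => ?_⟩
  obtain ⟨p, hp, hpk, hpq⟩ := Reliability.exists_norm_eq_one_near hq hδ
  obtain ⟨ε, hε, hball⟩ := key p hp hpk
  have hp0 : p ≠ 0 := norm_pos_iff.1 (by rw [hp]; exact one_pos)
  -- The points of modulus greater than `1` whose direction is close to `q` form an open set.
  have hopen : IsOpen {z : ℂ | 1 < ‖z‖} := isOpen_lt continuous_const continuous_norm
  have hcont : ContinuousOn (fun z : ℂ => ‖z / (‖z‖ : ℂ) - q‖) {z : ℂ | 1 < ‖z‖} := by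
    refine ((continuousOn_id.div (Complex.continuous_ofReal.comp continuous_norm).continuousOn
      fun z hz => ?_).sub continuousOn_const).norm
    have : (0 : ℝ) < ‖z‖ := one_pos.trans hz
    exact Complex.ofReal_ne_zero.2 this.ne'
  have hU := hcont.isOpen_inter_preimage hopen (isOpen_Iio (a := δ))
  -- It contains `(1 + ε / 2) * p`, which lies in the closure of the reliability zeros.
  let y : ℂ := ((1 + ε / 2 : ℝ) : ℂ) * p
  have hy : ‖y‖ = 1 + ε / 2 := by
    rw [norm_mul, hp, mul_one, Complex.norm_real, Real.norm_of_nonneg (by positivity)]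
  have hyc : y ∈ closure Reliability.reliabilityZeros := by
    apply hball
    rw [mem_ball_iff_norm, show y - p = ((ε / 2 : ℝ) : ℂ) * p by simp only [y]; push_cast; ring,
      norm_mul, hp, mul_one, Complex.norm_real, Real.norm_of_nonneg (by positivity)]
    linarith
  have hyU : y ∈ {z : ℂ | 1 < ‖z‖} ∩ (fun z : ℂ => ‖z / (‖z‖ : ℂ) - q‖) ⁻¹' Set.Iio δ := by
    constructor
    · change 1 < ‖y‖
      rw [hy]
      linarith
    · change ‖y / (‖y‖ : ℂ) - q‖ < δ
      have : ((1 + ε / 2 : ℝ) : ℂ) ≠ 0 := Complex.ofReal_ne_zero.2 (by positivity)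
      rwa [hy, show y = ((1 + ε / 2 : ℝ) : ℂ) * p from rfl, mul_div_cancel_left₀ _ this]
  obtain ⟨z, hz, hzZ⟩ := mem_closure_iff.1 hyc _ hU hyU
  exact ⟨z, hzZ, hz.1, hz.2⟩
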